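/- **Definitions.** A *geometric $(n_k)$ configuration* is a set of $n$ points and $n$ straight lines in the Euclidean plane $\mathbb{E}^2$ such that each line passes through exactly $k$ of the points and each point lies on exactly $k$ of the lines; configurations in the extended Euclidean (real projective) plane $\mathbb{E}^{2+}$ are defined in the same way. The celestial configuration $m\#(s_1,t_1;\dots;s_h,t_h)$ is built as follows: $(v_0)_i$, $i\in\mathbb{Z}_m$, are the consecutive vertices of a regular $m$-gon; for $j=0,\dots,h-1$ the line $(L_j)_i$ joins $(v_j)_i$ and $(v_j)_{i+s_{j+1}}$, and $(v_{j+1})_i$ is the intersection point of $(L_j)_i$ and $(L_j)_{i-t_{j+1}}$; the symbol is admissible if $(v_h)_i=(v_0)_{i+\delta}$ for all $i$, where $\delta=\frac12\sum_j(s_j-t_j)$, and the points $(v_j)_i$ and lines $(L_j)_i$ with $0\le j<h$ form an $((mh)_4)$ configuration. A *diameter* is a line through the center and one of the points $(v_0)_i$. A configuration in $\mathbb{E}^2$ *has independent pencils of $p$ and $q$ parallel lines* if it contains $p$ mutually parallel lines and $q$ mutually parallel lines of a different direction such that no point of the configuration lies on a line of both families. **Lemma.** Let $\ell\ge 5$ and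 let $m=2\ell+1$. Then $m\#(5,1;2,3;4,5;1,2;3,4)$ is a celestial $((5m)_4)$ configuration, with twist $\delta=0$. Choose the coordinates so that $(v_0)_i=\bigl(\cos(\tfrac{\pi}{2}+\tfrac{2\pi i}{m}),\,\sin(\tfrac{\pi}{2}+\tfrac{2\pi i}{m})\bigr)$. Adding to it all $m$ diameters and the $m$ points at infinity in the directions $\frac{2i\pi}{m}$ gives a $((12\ell+6)_5)$ configuration $\mathcal{D}_5(\ell)$ in $\mathbb{E}^{2+}$. There are projective transformations that map all points of $\mathcal{D}_5(\ell)$ into $\mathbb{E}^2$, and each of them maps $\mathcal{D}_5(\ell)$ to a geometric $((12\ell+6)_5)$ configuration in $\mathbb{E}^2$ that has independent pencils of $p=1$ and $q=1$ lines. Moreover, the transformation can be chosen such that no two distinct lines of the image are parallel, so that $p=q=1$ are then the largest possible sizes of such pencils. -/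

import Mathlib

noncomputable section

namespace DFive

/-! ### Configurations -/

/-- `n` points and `n` lines such that every line passes through exactly `k` of the points and
every point lies on exactly `k` of the lines. -/
def IsConfiguration {P L : Type*} (inc : P → L → Prop) (n k : ℕ)
    (pts : Set P) (lns : Set L) : Prop :=
  pts.Finite ∧ lns.Finite ∧ pts.ncard = n ∧ lns.ncard = n ∧
    (∀ l ∈ lns, {p ∈ pts | inc p l}.ncard = k) ∧
    (∀ p ∈ pts, {l ∈ lns | inc p l}.ncard = k)

/-- The Euclidean plane. -/
abbrev E2 : Type := EuclideanSpace ℝ (Fin 2)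

/-- A geometric `(n_k)` configuration: points and straight lines of the Euclidean plane. -/
def IsGeometricConfiguration (n k : ℕ) (pts : Set E2) (lns : Set (AffineSubspace ℝ E2)) : Prop :=
  (∀ l ∈ lns, (l : Set E2).Nonempty ∧ Module.finrank ℝ l.direction = 1) ∧
    IsConfiguration (fun p l => p ∈ l) n k pts lns

/-- The configuration contains two independent pencils, of `p` and of `q` parallel lines: the lines
within each pencil are parallel, the two pencils have different directions, and no point of the
configuration lies on a line of both pencils. -/
def HasIndependentPencils (p q : ℕ) (pts : Set E2) (lns : Set (AffineSubspace ℝ E2)) : Prop :=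
  ∃ P Q : Finset (AffineSubspace ℝ E2), (P : Set (AffineSubspace ℝ E2)) ⊆ lns ∧
    (Q : Set (AffineSubspace ℝ E2)) ⊆ lns ∧ P.card = p ∧ Q.card = q ∧
    (∀ a ∈ P, ∀ b ∈ P, a.Parallel b) ∧ (∀ a ∈ Q, ∀ b ∈ Q, a.Parallel b) ∧
    (∀ a ∈ P, ∀ b ∈ Q, ¬ a.Parallel b) ∧
    (∀ x ∈ pts, ∀ a ∈ P, ∀ b ∈ Q, ¬ (x ∈ a ∧ x ∈ b))

/-! ### The extended Euclidean plane

The extended Euclidean plane is the projective plane of `ℝ³`: its points are the one-dimensional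
and its lines the two-dimensional subspaces, incidence is inclusion, the join of two points is
their supremum, and the meet of two lines is their infimum. -/

/-- The lattice of subspaces of `ℝ³`. -/
abbrev Flat : Type := Submodule ℝ (Fin 3 → ℝ)

/-- An `(n_k)` configuration in the extended Euclidean plane. -/
def IsExtendedConfiguration (n k : ℕ) (pts lns : Set Flat) : Prop :=
  (∀ p ∈ pts, Module.finrank ℝ p = 1) ∧ (∀ l ∈ lns, Module.finrank ℝ l = 2) ∧
    IsConfiguration (fun p l : Flat => p ≤ l) n k pts lns

/-- The line at infinity. -/
def lineAtInfinity : Flat := LinearMap.ker (LinearMap.proj 2 : (Fin 3 → ℝ) →ₗ[ℝ] ℝ)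

/-- The point of the extended plane with Cartesian coordinates `(x, y)`. -/
def ordinaryPoint (x y : ℝ) : Flat := Submodule.span ℝ {![x, y, 1]}

/-- The point at infinity in the direction that makes the angle `θ` with the first axis. -/
def pointAtInfinity (θ : ℝ) : Flat := Submodule.span ℝ {![Real.cos θ, Real.sin θ, 0]}

/-- The points of the Euclidean plane that belong to a set of points of the extended plane. -/
def affinePoints (pts : Set Flat) : Set E2 := {x | ordinaryPoint (x 0) (x 1) ∈ pts}

/-- The set of all points of the Euclidean plane on a line of the extended plane. -/
def affineLine (W : Flat) : AffineSubspace ℝ E2 where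
  carrier := {x | ![x 0, x 1, 1] ∈ W}
  smul_vsub_vadd_mem' := by
    intro c x y z hx hy hz
    have h := W.add_mem (W.smul_mem c (W.sub_mem hx hy)) hz
    have e : (![(c • (x -ᵥ y) +ᵥ z) 0, (c • (x -ᵥ y) +ᵥ z) 1, 1] : Fin 3 → ℝ)
        = c • (![x 0, x 1, 1] - ![y 0, y 1, 1]) + ![z 0, z 1, 1] := by
      ext i
      fin_cases i <;> simp
    change (![(c • (x -ᵥ y) +ᵥ z) 0, (c • (x -ᵥ y) +ᵥ z) 1, 1] : Fin 3 → ℝ) ∈ W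
    rw [e]
    exact h

/-- The lines of the Euclidean plane given by a set of lines of the extended plane. -/
def affineLines (lns : Set Flat) : Set (AffineSubspace ℝ E2) := affineLine '' lns

/-- A projective transformation of the extended plane, induced by a linear automorphism of `ℝ³`,
applied to a set of points or to a set of lines. -/
def projImage (f : (Fin 3 → ℝ) ≃ₗ[ℝ] (Fin 3 → ℝ)) (S : Set Flat) : Set Flat :=
  (fun W => Submodule.map (f : (Fin 3 → ℝ) →ₗ[ℝ] (Fin 3 → ℝ)) W) '' S

/-- The projective transformation moves all the given points into the Euclidean plane. -/
def ProjectsIntoPlane (f : (Fin 3 → ℝ) ≃ₗ[ℝ] (Fin 3 → ℝ)) (pts : Set Flat) : Prop :=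
  ∀ p ∈ projImage f pts, ¬ p ≤ lineAtInfinity

/-! ### Celestial configurations

The symbol `m#(s₁,t₁;…;s_h,t_h)` is given by `m` and the list of the pairs `(s_j, t_j)`, indexed
from `0`. The second index of a point or a line is an integer that matters only modulo `m`. -/

/-- Vertices of the regular `m`-gon on the unit circle, placed with vertex `0` in the direction of
the second axis. -/
def vertex (m : ℕ) (i : ℤ) : Flat :=
  ordinaryPoint (Real.cos (Real.pi / 2 + 2 * Real.pi * i / m))
    (Real.sin (Real.pi / 2 + 2 * Real.pi * i / m))

/-- The points `(v_j)_i`: class `0` is the regular `m`-gon, and `(v_{j+1})_i` is the meet of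
`(L_j)_i` and `(L_j)_{i-t_j}`, where `(L_j)_i` is the join of `(v_j)_i` and `(v_j)_{i+s_j}`. -/
def celestialPoint (m : ℕ) (sym : List (ℤ × ℤ)) : ℕ → ℤ → Flat
  | 0, i => vertex m i
  | j + 1, i =>
    (celestialPoint m sym j i ⊔ celestialPoint m sym j (i + (sym.getD j (0, 0)).1)) ⊓
      (celestialPoint m sym j (i - (sym.getD j (0, 0)).2) ⊔
        celestialPoint m sym j (i - (sym.getD j (0, 0)).2 + (sym.getD j (0, 0)).1))

/-- The line `(L_j)_i`, the join of `(v_j)_i` and `(v_j)_{i+s_j}`. -/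
def celestialLine (m : ℕ) (sym : List (ℤ × ℤ)) (j : ℕ) (i : ℤ) : Flat :=
  celestialPoint m sym j i ⊔ celestialPoint m sym j (i + (sym.getD j (0, 0)).1)

/-- All points of the construction with the given symbol. -/
def celestialPoints (m : ℕ) (sym : List (ℤ × ℤ)) : Set Flat :=
  {p | ∃ j < sym.length, ∃ i : ℤ, p = celestialPoint m sym j i}

/-- All lines of the construction with the given symbol. -/
def celestialLines (m : ℕ) (sym : List (ℤ × ℤ)) : Set Flat :=
  {l | ∃ j < sym.length, ∃ i : ℤ, l = celestialLine m sym j i}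

/-- Rotation of the extended plane about the origin by the angle `θ`. -/
def rotation (θ : ℝ) : (Fin 3 → ℝ) →ₗ[ℝ] (Fin 3 → ℝ) :=
  Matrix.toLin' !![Real.cos θ, -Real.sin θ, 0; Real.sin θ, Real.cos θ, 0; 0, 0, 1]

/-- The construction with the given symbol really yields a celestial 4-configuration, that is, an
`((mh)_4)` configuration of ordinary points, on whose `h` classes of points and of lines the
rotation by `2π/m` acts by `i ↦ i + 1`, with the incidences of the reduced Levi graph: `(L_j)_i`
passes through `(v_j)_i`, `(v_j)_{i+s_j}`, `(v_{j+1})_i`, `(v_{j+1})_{i+t_j}`, where `(v_h)_i` is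
`(v_0)_{i+δ}` for the twist `δ = ½ ∑ (s_j - t_j)`. -/
structure IsCelestial (m : ℕ) (sym : List (ℤ × ℤ)) : Prop where
  config : IsExtendedConfiguration (m * sym.length) 4 (celestialPoints m sym)
    (celestialLines m sym)
  ordinary : ∀ p ∈ celestialPoints m sym, ¬ p ≤ lineAtInfinity
  rotate_point : ∀ j < sym.length, ∀ i : ℤ,
    (celestialPoint m sym j i).map (rotation (2 * Real.pi / m)) = celestialPoint m sym j (i + 1)
  rotate_line : ∀ j < sym.length, ∀ i : ℤ,
    (celestialLine m sym j i).map (rotation (2 * Real.pi / m)) = celestialLine m sym j (i + 1)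
  incidence : ∀ j < sym.length, ∀ i : ℤ,
    celestialPoint m sym j i ≤ celestialLine m sym j i ∧
    celestialPoint m sym j (i + (sym.getD j (0, 0)).1) ≤ celestialLine m sym j i ∧
    celestialPoint m sym (j + 1) i ≤ celestialLine m sym j i ∧
    celestialPoint m sym (j + 1) (i + (sym.getD j (0, 0)).2) ≤ celestialLine m sym j i
  closing : ∃ δ : ℤ, 2 * δ = (sym.map fun a => a.1 - a.2).sum ∧
    ∀ i : ℤ, celestialPoint m sym sym.length i = celestialPoint m sym 0 (i + δ)

/-- The diameter through `(v_0)_i`: its join with the center. -/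
def diameter (m : ℕ) (i : ℤ) : Flat := vertex m i ⊔ ordinaryPoint 0 0

/-- The symbol `(5,1;2,3;4,5;1,2;3,4)`. -/
def symbolD5 : List (ℤ × ℤ) := [(5, 1), (2, 3), (4, 5), (1, 2), (3, 4)]

/-- Points of the construction: the points of the celestial configuration
`(2ℓ+1)#(5,1;2,3;4,5;1,2;3,4)` and the points at infinity in the directions `2iπ/(2ℓ+1)`. -/
def D5Points (ℓ : ℕ) : Set Flat :=
  celestialPoints (2 * ℓ + 1) symbolD5 ∪
    {p | ∃ i : ℤ, p = pointAtInfinity (2 * i * Real.pi / (2 * ℓ + 1))}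

/-- Lines of the construction: the lines of the celestial configuration
`(2ℓ+1)#(5,1;2,3;4,5;1,2;3,4)` and all diameters. -/
def D5Lines (ℓ : ℕ) : Set Flat :=
  celestialLines (2 * ℓ + 1) symbolD5 ∪ {l | ∃ i : ℤ, l = diameter (2 * ℓ + 1) i}

end DFive

end

/-!
In polar coordinates about the center, the angle of every celestial point, and of the normal of
every celestial line, is a fixed direction plus a multiple of `π / m`, while the radius or the
distance from the center depends only on the class and is a quotient of products of cosines of such
multiples. Whether point `b` of one class lies on line `a` of another is therefore an equation
between such products that involves `b - a` only. All incidences are recorded by finite subsets of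
`ZMod m`, whose cardinalities, summed along rows and columns, are the degrees of the configuration.
Accidental incidences amount to equalities between products of cosines; strict monotonicity of the
cosine excludes them once `m ≥ 11`, which is `ℓ ≥ 5`.

As `m` is odd, `2` is invertible modulo `m`. Hence a diameter meets each class of points exactly
once, and a point at infinity lies on exactly one line of each class.

Send to infinity a line that avoids the finitely many points of the configuration and the finitely
many meets of its lines: then no two image lines are parallel. Under an arbitrary projective
transformation, consider the line `(L_0)_0` and the diameters through `(v_0)_1` and `(v_0)_4`. The
diameters cut it in two distinct points outside the configuration. These do not both go to infinity,
since otherwise the line itself would, together with its configuration points. So the image of the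
line and that of one of the diameters are not parallel and share no configuration point.
-/

noncomputable section

namespace DFive

open Real

/-! ### Configurations from voltage tables -/

section Voltage

open scoped Pointwise

variable {P L C D G : Type*} [AddCommGroup G] {inc : P → L → Prop} {p : C → G → P}
  {l : D → G → L} {E : C → D → Finset G}

/-- The incidences between the classes `p k` of points and `l j` of lines, both indexed by a group,
are those of the derived graph of the voltage table `E`: point `b` of class `k` lies on line `a` of
class `j` exactly when `b - a` is one of the voltages `E k j`. -/
def IsVoltageTable (inc : P → L → Prop) (p : C → G → P) (l : D → G → L) (E : C → D → Finset G) :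
    Prop :=
  ∀ k j b a, inc (p k b) (l j a) ↔ b - a ∈ E k j

/-- No row of the table is a translate of a different row, and no row is invariant under a
nontrivial translation. -/
def RowsSeparated (E : C → D → Finset G) : Prop :=
  ∀ k k' x, (∀ j c, c ∈ E k j ↔ c + x ∈ E k' j) → k = k' ∧ x = 0

theorem IsVoltageTable.flip [DecidableEq G] (h : IsVoltageTable inc p l E) :
    IsVoltageTable (flip inc) l p fun j k => -E k j := by
  intro j k a b
  rw [Finset.mem_neg', neg_sub]
  exact h k j b a

theorem IsVoltageTable.injective_uncurry (h : IsVoltageTable inc p l E) (hE : RowsSeparated E) :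
    Function.Injective (Function.uncurry p) := by
  rintro ⟨k, b⟩ ⟨k', b'⟩ (heq : p k b = p k' b')
  obtain ⟨rfl, hb⟩ := hE k k' (b' - b) fun j c => by
    have := h k j b (b - c)
    rw [heq, h k' j] at this
    rw [show c + (b' - b) = b' - (b - c) by abel, this, sub_sub_cancel]
  rw [sub_eq_zero.1 hb]

theorem IsVoltageTable.ncard_points_on_line [Fintype C] (h : IsVoltageTable inc p l E)
    (hE : RowsSeparated E) (j : D) (a : G) :
    {q ∈ Set.range (Function.uncurry p) | inc q (l j a)}.ncard = ∑ k, (E k j).card := by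
  let q : (Σ _ : C, G) → P := fun x => p x.1 (x.2 + a)
  have hq : Function.Injective q := by
    rintro ⟨k, c⟩ ⟨k', c'⟩ heq
    obtain ⟨rfl, hc⟩ := Prod.mk.inj (h.injective_uncurry hE (a₁ := (_, _)) (a₂ := (_, _)) heq)
    rw [add_right_cancel (show c + a = c' + a from hc)]
  have hset : {q ∈ Set.range (Function.uncurry p) | inc q (l j a)} =
      q '' (Finset.univ.sigma fun k => E k j : Finset (Σ _ : C, G)) := by
    ext x
    constructor
    · rintro ⟨⟨⟨k, b⟩, rfl⟩, hx⟩
      exact ⟨⟨k, b - a⟩, by simpa using (h k j b a).1 hx, by simp [q]⟩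
    · rintro ⟨⟨k, c⟩, hx, rfl⟩
      exact ⟨⟨(k, c + a), rfl⟩, (h k j _ a).2 (by simpa using hx)⟩
  rw [hset, Set.ncard_image_of_injective _ hq, Set.ncard_coe_finset, Finset.card_sigma]

theorem IsVoltageTable.isConfiguration [DecidableEq G] [Fintype C] [Fintype D] [Finite G] {n : ℕ}
    (h : IsVoltageTable inc p l E) (hrows : RowsSeparated E)
    (hcols : RowsSeparated fun j k => -E k j) (hCD : Fintype.card D = Fintype.card C)
    (hcol : ∀ j, ∑ k, (E k j).card = n) (hrow : ∀ k, ∑ j, (E k j).card = n) :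
    IsConfiguration inc (Fintype.card C * Nat.card G) n (Set.range (Function.uncurry p))
      (Set.range (Function.uncurry l)) := by
  refine ⟨Set.finite_range _, Set.finite_range _, ?_, ?_, ?_, ?_⟩
  · rw [Set.ncard_range_of_injective (h.injective_uncurry hrows), Nat.card_prod,
      Nat.card_eq_fintype_card]
  · rw [Set.ncard_range_of_injective (h.flip.injective_uncurry hcols), Nat.card_prod,
      Nat.card_eq_fintype_card, hCD]
  · rintro _ ⟨⟨j, a⟩, rfl⟩
    exact (h.ncard_points_on_line hrows j a).trans (hcol j)
  · rintro _ ⟨⟨k, b⟩, rfl⟩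
    refine (h.flip.ncard_points_on_line hcols k b).trans ?_
    simp only [Finset.card_neg, hrow]

theorem range_uncurry_cast_eq {m : ℕ} {p : C → ℤ → P} (hp : ∀ k, Function.Periodic (p k) m) :
    Set.range (Function.uncurry fun k (x : ZMod m) => p k x.cast) =
      Set.range (Function.uncurry p) := by
  refine Set.Subset.antisymm (Set.range_subset_iff.2 fun x => ⟨(x.1, x.2.cast), rfl⟩) ?_
  rintro _ ⟨⟨k, b⟩, rfl⟩
  refine ⟨(k, b), ?_⟩
  simp only [Function.uncurry_apply_pair, ZMod.coe_intCast, Int.emod_def, mul_comm (m : ℤ)]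
  exact (hp k).sub_int_mul_eq (b / m)

theorem isConfiguration_of_periodic {m n : ℕ} [NeZero m] [Fintype C] [Fintype D] {p : C → ℤ → P}
    {l : D → ℤ → L} {E : C → D → Finset (ZMod m)} (hp : ∀ k, Function.Periodic (p k) m)
    (hl : ∀ j, Function.Periodic (l j) m)
    (h : ∀ k j (b a : ℤ), inc (p k b) (l j a) ↔ ((b - a : ℤ) : ZMod m) ∈ E k j)
    (hrows : RowsSeparated E) (hcols : RowsSeparated fun j k => -E k j)
    (hCD : Fintype.card D = Fintype.card C) (hcol : ∀ j, ∑ k, (E k j).card = n)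
    (hrow : ∀ k, ∑ j, (E k j).card = n) :
    IsConfiguration inc (Fintype.card C * m) n (Set.range (Function.uncurry p))
      (Set.range (Function.uncurry l)) := by
  have htable : IsVoltageTable inc (fun k (x : ZMod m) => p k x.cast)
      (fun j (x : ZMod m) => l j x.cast) E := by
    intro k j b a
    rw [h, Int.cast_sub, ZMod.intCast_zmod_cast, ZMod.intCast_zmod_cast]
  simpa only [range_uncurry_cast_eq hp, range_uncurry_cast_eq hl, Nat.card_zmod] using
    htable.isConfiguration hrows hcols hCD hcol hrow

end Voltage

section PermVoltage

open scoped Pointwise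

variable {C D G : Type*}

/-- No nontrivial translation maps the set to itself. -/
def IsAperiodic [AddCommGroup G] (A : Finset G) : Prop := ∀ x, (∀ c, c ∈ A ↔ c + x ∈ A) → x = 0

theorem IsAperiodic.neg [AddCommGroup G] [DecidableEq G] {A : Finset G} (hA : IsAperiodic A) :
    IsAperiodic (-A) := by
  refine fun x hx => neg_eq_zero.1 (hA (-x) fun c => ?_)
  have := hx (-c)
  rwa [Finset.mem_neg', Finset.mem_neg', neg_neg, neg_add, neg_neg] at this

theorem isAperiodic_singleton [AddCommGroup G] (a : G) : IsAperiodic {a} := fun x hx => by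
  have := hx a
  simpa using this

/-- The voltage table in which class `j` of lines meets only the classes `j` and `σ j` of points,
with voltages `A j` and `B j`. -/
def permVoltage [DecidableEq C] (σ : Equiv.Perm C) (A B : C → Finset G) (k j : C) : Finset G :=
  if k = j then A j else if k = σ j then B j else ∅

section Perm

variable [DecidableEq C] {σ : Equiv.Perm C} {A B : C → Finset G}

theorem permVoltage_self (σ : Equiv.Perm C) (A B : C → Finset G) (j : C) :
    permVoltage σ A B j j = A j := if_pos rfl

theorem nonempty_permVoltage_iff (hA : ∀ j, (A j).Nonempty) (hB : ∀ j, (B j).Nonempty) (k j : C) :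
    (permVoltage σ A B k j).Nonempty ↔ k = j ∨ k = σ j := by
  unfold permVoltage
  split_ifs <;> simp_all

theorem rowsSeparated_permVoltage [AddCommGroup G] (hσσ : ∀ j, σ (σ j) ≠ j)
    (hA : ∀ j, (A j).Nonempty) (hB : ∀ j, (B j).Nonempty) (hper : ∀ j, IsAperiodic (A j)) :
    RowsSeparated (permVoltage σ A B) := by
  intro k k' x h
  have hsupp (j : C) : k = j ∨ k = σ j ↔ k' = j ∨ k' = σ j := by
    rw [← nonempty_permVoltage_iff hA hB, ← nonempty_permVoltage_iff hA hB]
    refine ⟨fun ⟨c, hc⟩ => ⟨c + x, (h j c).1 hc⟩, fun ⟨c, hc⟩ => ⟨c - x, (h j _).2 ?_⟩⟩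
    rwa [sub_add_cancel]
  have hk : k = k' := by
    rcases (hsupp k).1 (.inl rfl) with hk | hk
    · exact hk.symm
    · rcases (hsupp k').2 (.inl rfl) with hk' | hk'
      · exact hk'
      · exact absurd (hk' ▸ hk.symm) (hσσ k')
  subst hk
  exact ⟨rfl, hper k x fun c => by simpa only [permVoltage_self] using h k c⟩

theorem neg_permVoltage_flip [AddCommGroup G] [DecidableEq G] (A B : C → Finset G) :
    (fun j k => -permVoltage σ A B k j) =
      permVoltage σ.symm (fun j => -A j) fun k => -B (σ.symm k) := by
  funext j k
  unfold permVoltage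
  obtain rfl | hkj := eq_or_ne k j
  · rw [if_pos rfl, if_pos rfl]
  · by_cases hk : k = σ j
    · rw [if_neg hkj, if_pos hk, if_neg hkj.symm, if_pos (σ.eq_symm_apply.2 hk.symm), hk]
      simp only [σ.symm_apply_apply]
    · rw [if_neg hkj, if_neg hk, if_neg hkj.symm,
        if_neg fun hj => hk (σ.eq_symm_apply.1 hj).symm, Finset.neg_empty]

theorem columnsSeparated_permVoltage [AddCommGroup G] [DecidableEq G]
    (hσσ : ∀ j, σ (σ j) ≠ j) (hA : ∀ j, (A j).Nonempty) (hB : ∀ j, (B j).Nonempty)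
    (hper : ∀ j, IsAperiodic (A j)) : RowsSeparated fun j k => -permVoltage σ A B k j := by
  rw [neg_permVoltage_flip]
  refine rowsSeparated_permVoltage (fun j h => hσσ j ?_) (fun j => (hA j).neg)
    (fun j => (hB _).neg) fun j => (hper j).neg
  rw [← σ.symm_apply_eq.1 (σ.symm_apply_eq.1 h)]

theorem sum_card_permVoltage_column [Fintype C] (hσ : ∀ j, σ j ≠ j) (j : C) :
    ∑ k, (permVoltage σ A B k j).card = (A j).card + (B j).card := by
  have hcard (k : C) : (permVoltage σ A B k j).card =
      (if k = j then (A j).card else 0) + if k = σ j then (B j).card else 0 := by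
    have := hσ j
    unfold permVoltage
    split_ifs <;> simp_all
  simp only [hcard, Finset.sum_add_distrib, Finset.sum_ite_eq', Finset.mem_univ, if_true]

theorem sum_card_permVoltage_row [AddCommGroup G] [Fintype C] (hσ : ∀ j, σ j ≠ j) (k : C) :
    ∑ j, (permVoltage σ A B k j).card = (A k).card + (B (σ.symm k)).card := by
  classical
  have := sum_card_permVoltage_column (σ := σ.symm) (A := fun j => -A j)
    (B := fun k => -B (σ.symm k)) (fun j h => hσ j (σ.symm_apply_eq.1 h).symm) k
  simpa only [← neg_permVoltage_flip, Finset.card_neg] using this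

end Perm

theorem rowsSeparated_option [AddCommGroup G] {F : Option C → Option D → Finset G}
    (hF : RowsSeparated fun k j => F (some k) (some j)) (hnone : F none none = ∅)
    (hne : ∀ k, (F (some k) none).Nonempty) {j₀ : D} (hper : IsAperiodic (F none (some j₀))) :
    RowsSeparated F := by
  rintro (_ | k) (_ | k') x h
  · exact ⟨rfl, hper x (h (some j₀))⟩
  · obtain ⟨c, hc⟩ := hne k'
    have := (h none (c - x)).2 (by rwa [sub_add_cancel])
    simp [hnone] at this
  · obtain ⟨c, hc⟩ := hne k
    have := (h none c).1 hc
    simp [hnone] at this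
  · obtain ⟨rfl, hx⟩ := hF k k' x fun j => h (some j)
    exact ⟨rfl, hx⟩

end PermVoltage

/-! ### Points and lines in polar coordinates -/

section Finrank

variable {K V : Type*} [DivisionRing K] [AddCommGroup V] [Module K V] {p q l l' : Submodule K V}

theorem covBy_of_finrank_eq_add_one (hpl : p ≤ l)
    (h : Module.finrank K l = Module.finrank K p + 1) : p ⋖ l := by
  have : FiniteDimensional K l := Module.finite_of_finrank_pos (by omega)
  refine ⟨lt_of_le_of_ne hpl ?_, fun c hpc hcl => ?_⟩
  · rintro rfl
    omega
  · have := Submodule.finiteDimensional_of_le hcl.le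
    have := Submodule.finrank_lt_finrank_of_lt hpc
    have := Submodule.finrank_lt_finrank_of_lt hcl
    omega

theorem sup_eq_of_finrank_eq (hp : Module.finrank K p = 1)
    (hq : Module.finrank K q = 1) (hl : Module.finrank K l = 2) (hpl : p ≤ l) (hql : q ≤ l)
    (hpq : p ≠ q) : p ⊔ q = l :=
  (covBy_of_finrank_eq_add_one hpl (by omega)).wcovBy.sup_eq
    (covBy_of_finrank_eq_add_one hql (by omega)).wcovBy hpq

theorem inf_eq_of_finrank_eq (hp : Module.finrank K p = 1)
    (hl : Module.finrank K l = 2) (hl' : Module.finrank K l' = 2) (hpl : p ≤ l) (hpl' : p ≤ l')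
    (hll' : l ≠ l') : l ⊓ l' = p :=
  (covBy_of_finrank_eq_add_one hpl (by omega)).wcovBy.inf_eq
    (covBy_of_finrank_eq_add_one hpl' (by omega)).wcovBy hll'

end Finrank

/-- The point of the Euclidean plane with polar coordinates `r` and `θ`; here `r` may be any real
number. -/
def polarPoint (r θ : ℝ) : Flat := ordinaryPoint (r * cos θ) (r * sin θ)

/-- The line of the Euclidean plane whose unit normal vector has the angle `φ` and whose signed
distance from the origin is `d`, that is, `x cos φ + y sin φ = d`. -/
def polarLine (d φ : ℝ) : Flat := LinearMap.ker (dotProductBilin ℝ ℝ ![cos φ, sin φ, -d])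

theorem finrank_ordinaryPoint (x y : ℝ) : Module.finrank ℝ (ordinaryPoint x y) = 1 :=
  finrank_span_singleton fun h => by simpa using congrFun h 2

theorem finrank_pointAtInfinity (θ : ℝ) : Module.finrank ℝ (pointAtInfinity θ) = 1 := by
  refine finrank_span_singleton fun h => ?_
  have hcos : cos θ = 0 := congrFun h 0
  have hsin : sin θ = 0 := congrFun h 1
  simpa [hcos, hsin] using sin_sq_add_cos_sq θ

theorem finrank_polarLine (d φ : ℝ) : Module.finrank ℝ (polarLine d φ) = 2 := by
  have hne : (dotProductBilin ℝ ℝ ![cos φ, sin φ, -d] : Module.Dual ℝ (Fin 3 → ℝ)) ≠ 0 := by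
    intro h
    have := LinearMap.congr_fun h ![cos φ, sin φ, 0]
    simp [← sq] at this
  have := Module.Dual.finrank_ker_add_one_of_ne_zero hne
  rw [Module.finrank_fin_fun] at this
  exact Nat.succ_injective this

theorem not_ordinaryPoint_le_lineAtInfinity (x y : ℝ) :
    ¬ ordinaryPoint x y ≤ lineAtInfinity := by
  simp [ordinaryPoint, lineAtInfinity]

theorem ordinaryPoint_le_polarLine_iff {x y d φ : ℝ} :
    ordinaryPoint x y ≤ polarLine d φ ↔ x * cos φ + y * sin φ = d := by
  have hdot : ![cos φ, sin φ, -d] ⬝ᵥ ![x, y, 1] = x * cos φ + y * sin φ - d := by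
    simp [dotProduct, Fin.sum_univ_three]
    ring
  rw [ordinaryPoint, polarLine, Submodule.span_singleton_le_iff_mem, LinearMap.mem_ker,
    dotProductBilin_apply_apply, hdot, sub_eq_zero]

theorem polarPoint_le_polarLine_iff {r θ d φ : ℝ} :
    polarPoint r θ ≤ polarLine d φ ↔ r * cos (θ - φ) = d := by
  rw [polarPoint, ordinaryPoint_le_polarLine_iff, cos_sub]
  ring_nf

theorem pointAtInfinity_le_polarLine_iff {θ d φ : ℝ} :
    pointAtInfinity θ ≤ polarLine d φ ↔ cos (θ - φ) = 0 := by
  rw [pointAtInfinity, polarLine, Submodule.span_singleton_le_iff_mem, LinearMap.mem_ker, cos_sub]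
  simp [dotProduct, Fin.sum_univ_three, mul_comm]

theorem polarPoint_sup_polarPoint {r α : ℝ} (hr : r ≠ 0) (hα : sin α ≠ 0) (θ : ℝ) :
    polarPoint r (θ - α) ⊔ polarPoint r (θ + α) = polarLine (r * cos α) θ := by
  refine sup_eq_of_finrank_eq (finrank_ordinaryPoint _ _) (finrank_ordinaryPoint _ _)
    (finrank_polarLine _ _) ?_ ?_ fun heq => ?_
  · rw [polarPoint_le_polarLine_iff, sub_sub_cancel_left, cos_neg]
  · rw [polarPoint_le_polarLine_iff, add_sub_cancel_left]
  · -- The line through `θ - α` parallel to the normal separates the two points.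
    have h : polarPoint r (θ - α) ≤ polarLine (-(r * sin α)) (θ + π / 2) := by
      rw [polarPoint_le_polarLine_iff, show θ - α - (θ + π / 2) = -(α + π / 2) by ring, cos_neg,
        cos_add_pi_div_two, mul_neg]
    rw [heq, polarPoint_le_polarLine_iff, add_sub_add_left_eq_sub, cos_sub_pi_div_two] at h
    exact mul_ne_zero hr hα (by linarith)

theorem polarLine_inf_polarLine {α : ℝ} (hsin : sin α ≠ 0) (hcos : cos α ≠ 0) (d θ : ℝ) :
    polarLine d (θ + α) ⊓ polarLine d (θ - α) = polarPoint (d / cos α) θ := by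
  refine inf_eq_of_finrank_eq (finrank_ordinaryPoint _ _) (finrank_polarLine _ _)
    (finrank_polarLine _ _) ?_ ?_ fun heq => ?_
  · rw [polarPoint_le_polarLine_iff, sub_add_cancel_left, cos_neg, div_mul_cancel₀ _ hcos]
  · rw [polarPoint_le_polarLine_iff, sub_sub_cancel, div_mul_cancel₀ _ hcos]
  · -- The point at infinity of the first line does not lie on the second.
    have h : pointAtInfinity (θ + α + π / 2) ≤ polarLine d (θ + α) := by
      rw [pointAtInfinity_le_polarLine_iff, add_sub_cancel_left, cos_pi_div_two]
    rw [heq, pointAtInfinity_le_polarLine_iff, show θ + α + π / 2 - (θ - α) = 2 * α + π / 2 by ring,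
      cos_add_pi_div_two, sin_two_mul] at h
    simp [hsin, hcos] at h

theorem polarPoint_sup_origin {r : ℝ} (hr : r ≠ 0) (φ : ℝ) :
    polarPoint r (π / 2 + φ) ⊔ ordinaryPoint 0 0 = polarLine 0 φ := by
  refine sup_eq_of_finrank_eq (finrank_ordinaryPoint _ _) (finrank_ordinaryPoint _ _)
    (finrank_polarLine _ _) ?_ ?_ fun heq => ?_
  · rw [polarPoint_le_polarLine_iff, add_sub_cancel_right, cos_pi_div_two, mul_zero]
  · simp only [ordinaryPoint_le_polarLine_iff, zero_mul, add_zero]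
  · have h : polarPoint r (π / 2 + φ) ≤ polarLine r (π / 2 + φ) := by
      rw [polarPoint_le_polarLine_iff, sub_self, cos_zero, mul_one]
    rw [heq, ordinaryPoint_le_polarLine_iff] at h
    simp [hr.symm] at h

theorem map_rotation_polarPoint (α r θ : ℝ) :
    (polarPoint r θ).map (rotation α) = polarPoint r (θ + α) := by
  rw [polarPoint, polarPoint, ordinaryPoint, ordinaryPoint, Submodule.map_span,
    Set.image_singleton]
  congr 2
  ext c
  fin_cases c <;>
    simp [rotation, Matrix.mulVec, dotProduct, Fin.sum_univ_three, cos_add, sin_add] <;> ring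

/-! ### Multiples of the angle `π / m` -/

/-- The angle `nπ / m`, that is, `n` times half the central angle of a side of a regular `m`-gon.
All polar angles of points and lines of a celestial configuration have this form, up to a quarter
turn. -/
def stepAngle (m : ℕ) (n : ℤ) : ℝ := n * (π / m)

/-- The cosine of `stepAngle m n`. -/
def stepCos (m : ℕ) (n : ℤ) : ℝ := cos (stepAngle m n)

theorem stepAngle_add (m : ℕ) (a b : ℤ) :
    stepAngle m (a + b) = stepAngle m a + stepAngle m b := by
  rw [stepAngle, Int.cast_add, add_mul, stepAngle, stepAngle]

theorem stepAngle_neg (m : ℕ) (a : ℤ) : stepAngle m (-a) = -stepAngle m a := by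
  rw [stepAngle, Int.cast_neg, neg_mul, stepAngle]

theorem stepAngle_sub (m : ℕ) (a b : ℤ) :
    stepAngle m (a - b) = stepAngle m a - stepAngle m b := by
  rw [sub_eq_add_neg, stepAngle_add, stepAngle_neg, sub_eq_add_neg]

theorem stepAngle_mul_period {m : ℕ} (hm : m ≠ 0) (k : ℤ) :
    stepAngle m (2 * m * k) = k * (2 * π) := by
  simp only [stepAngle, Int.cast_mul, Int.cast_ofNat, Int.cast_natCast]
  field_simp

theorem sin_stepAngle_eq_zero_iff {m : ℕ} (hm : m ≠ 0) {n : ℤ} :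
    sin (stepAngle m n) = 0 ↔ (m : ℤ) ∣ n := by
  have hm' : (m : ℝ) ≠ 0 := Nat.cast_ne_zero.2 hm
  rw [sin_eq_zero_iff]
  refine exists_congr fun k => ?_
  rw [stepAngle, mul_div_assoc', eq_div_iff hm', mul_right_comm, mul_left_inj' pi_ne_zero,
    eq_comm, mul_comm (k : ℝ)]
  exact_mod_cast Iff.rfl

theorem stepCos_neg (m : ℕ) (n : ℤ) : stepCos m (-n) = stepCos m n := by
  rw [stepCos, stepAngle_neg, cos_neg, stepCos]

theorem stepCos_zero (m : ℕ) : stepCos m 0 = 1 := by simp [stepCos, stepAngle]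

theorem stepCos_add_period {m : ℕ} (hm : m ≠ 0) (n k : ℤ) :
    stepCos m (n + 2 * m * k) = stepCos m n := by
  rw [stepCos, stepAngle_add, stepAngle_mul_period hm, cos_add_int_mul_two_pi, stepCos]

theorem stepCos_mul (m : ℕ) (a b : ℤ) :
    stepCos m a * stepCos m b = (stepCos m (a + b) + stepCos m (a - b)) / 2 := by
  simp only [stepCos, stepAngle_add, stepAngle_sub, cos_add, cos_sub]
  ring

theorem stepCos_strictAntiOn (m : ℕ) : StrictAntiOn (stepCos m) (Set.Icc 0 m) := by
  rintro a ⟨ha, -⟩ b ⟨-, hb⟩ hab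
  have hm : (0 : ℝ) < m := by exact_mod_cast ha.trans_lt (hab.trans_le hb)
  have ha' : (0 : ℝ) ≤ a := by exact_mod_cast ha
  have hb' : (b : ℝ) ≤ m := by exact_mod_cast hb
  refine cos_lt_cos_of_nonneg_of_le_pi ?_ ?_ ?_
  · rw [stepAngle]
    exact mul_nonneg ha' (div_pos pi_pos hm).le
  · calc stepAngle m b ≤ m * (π / m) := by rw [stepAngle]; gcongr
      _ = π := mul_div_cancel₀ _ hm.ne'
  · rw [stepAngle, stepAngle]
    gcongr

theorem stepCos_pos {m : ℕ} {a : ℤ} (ha : 0 ≤ a) (ham : 2 * a < m) : 0 < stepCos m a := by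
  have hlt : stepCos m (m - a) < stepCos m a :=
    stepCos_strictAntiOn m ⟨ha, by omega⟩ ⟨by omega, by omega⟩ (by omega)
  have hneg : stepCos m (m - a) = -stepCos m a := by
    have hm : (m : ℝ) ≠ 0 := by
      have : (m : ℤ) ≠ 0 := by omega
      exact_mod_cast this
    have hpi : stepAngle m m = π := by
      rw [stepAngle, Int.cast_natCast, mul_div_cancel₀ _ hm]
    rw [stepCos, stepAngle_sub, hpi, cos_pi_sub, stepCos]
  linarith

theorem stepCos_two_mul_sub_eq_iff {m : ℕ} (hm : m ≠ 0) {n s : ℤ} :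
    stepCos m (2 * n - s) = stepCos m s ↔ (m : ℤ) ∣ n ∨ (m : ℤ) ∣ n - s := by
  have hprod : stepCos m (2 * n - s) - stepCos m s =
      -2 * sin (stepAngle m n) * sin (stepAngle m (n - s)) := by
    rw [show 2 * n - s = n + (n - s) by ring, show stepCos m s = stepCos m (n - (n - s)) by simp]
    simp only [stepCos, stepAngle_add, stepAngle_sub m n (n - s), cos_add, cos_sub]
    ring
  rw [← sub_eq_zero, hprod, mul_eq_zero, mul_eq_zero, sin_stepAngle_eq_zero_iff hm,
    sin_stepAngle_eq_zero_iff hm]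
  norm_num

theorem exists_stepCos_eq {m : ℕ} (hm : m ≠ 0) (n : ℤ) :
    ∃ e ∈ Set.Icc (0 : ℤ) m, 2 ∣ n - e ∧ stepCos m n = stepCos m e := by
  have h2m : (0 : ℤ) < 2 * m := by omega
  have hnonneg := Int.emod_nonneg n h2m.ne'
  have hlt := Int.emod_lt_of_pos n h2m
  have hn := Int.emod_add_mul_ediv n (2 * m)
  have heven : (2 : ℤ) ∣ 2 * m * (n / (2 * m)) := ⟨m * (n / (2 * m)), mul_assoc _ _ _⟩
  have hcos : stepCos m n = stepCos m (n % (2 * m)) := by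
    rw [← stepCos_add_period hm (n % (2 * m)), hn]
  by_cases hle : n % (2 * m) ≤ m
  · exact ⟨n % (2 * m), ⟨hnonneg, hle⟩, by omega, hcos⟩
  · refine ⟨2 * m - n % (2 * m), ⟨by omega, by omega⟩, by omega, ?_⟩
    rw [hcos, ← stepCos_neg, ← stepCos_add_period hm _ 1]
    congr 1
    ring

theorem stepCos_le_or_le_of_two_dvd_sub {m : ℕ} {a n : ℤ} (ha : 0 ≤ a) (ham : a + 2 ≤ m)
    (hn : 2 ∣ n - a) : stepCos m n ≤ stepCos m (a + 2) ∨ stepCos m a ≤ stepCos m n := by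
  obtain ⟨e, he, hne, hcos⟩ := exists_stepCos_eq (m := m) (by omega) n
  rw [hcos]
  rcases le_or_gt e a with hea | hae
  · exact .inr ((stepCos_strictAntiOn m).antitoneOn he ⟨ha, by omega⟩ hea)
  · exact .inl ((stepCos_strictAntiOn m).antitoneOn ⟨by omega, ham⟩ he (by omega))

theorem mul_stepCos_ne_of_between {m : ℕ} {a n : ℤ} {r d : ℝ} (ha : 0 ≤ a) (ham : a + 2 ≤ m)
    (hn : 2 ∣ n - a) (hr : 0 < r) (hlt : r * stepCos m (a + 2) < d) (hgt : d < r * stepCos m a) :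
    r * stepCos m n ≠ d := by
  rcases stepCos_le_or_le_of_two_dvd_sub ha ham hn with h | h
  · exact ((mul_le_mul_of_nonneg_left h hr.le).trans_lt hlt).ne
  · exact (hgt.trans_le (mul_le_mul_of_nonneg_left h hr.le)).ne'

theorem mul_stepCos_ne_of_lt {m : ℕ} {r d : ℝ} (hr : 0 ≤ r) (hd : r < d) (n : ℤ) :
    r * stepCos m n ≠ d :=
  ((mul_le_of_le_one_right hr (cos_le_one _)).trans_lt hd).ne

/-! ### Polar coordinates of celestial points and lines -/

section Celestial

/-- The entry `s` of the pair with index `j` of a symbol. -/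
def lineSpan (sym : List (ℤ × ℤ)) (j : ℕ) : ℤ := (sym.getD j (0, 0)).1

/-- The entry `t` of the pair with index `j` of a symbol. -/
def pointSpan (sym : List (ℤ × ℤ)) (j : ℕ) : ℤ := (sym.getD j (0, 0)).2

/-- The angle, in multiples of `π / m`, by which class `j` of points is turned against class `0`. -/
def celestialShift (sym : List (ℤ × ℤ)) (j : ℕ) : ℤ := ((sym.take j).map fun a => a.1 - a.2).sum

/-- The radius of the circle about the origin that contains class `j` of points. -/
def celestialRadius (m : ℕ) (sym : List (ℤ × ℤ)) : ℕ → ℝ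
  | 0 => 1
  | j + 1 => celestialRadius m sym j * stepCos m (lineSpan sym j) / stepCos m (pointSpan sym j)

/-- All entries of the symbol are positive and less than `m / 2`, so that no join or meet of the
construction degenerates. -/
def HasProperSpans (m : ℕ) (sym : List (ℤ × ℤ)) : Prop :=
  ∀ a ∈ sym, (0 < a.1 ∧ 2 * a.1 < m) ∧ (0 < a.2 ∧ 2 * a.2 < m)

variable {m : ℕ} {sym : List (ℤ × ℤ)} {j k : ℕ}

theorem HasProperSpans.of_lt_length (h : HasProperSpans m sym) (hj : j < sym.length) :
    (0 < lineSpan sym j ∧ 2 * lineSpan sym j < m) ∧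
      (0 < pointSpan sym j ∧ 2 * pointSpan sym j < m) := by
  rw [lineSpan, pointSpan, List.getD_eq_getElem _ _ hj]
  exact h _ (List.getElem_mem hj)

theorem celestialShift_zero (sym : List (ℤ × ℤ)) : celestialShift sym 0 = 0 := rfl

theorem celestialShift_succ (hj : j < sym.length) :
    celestialShift sym (j + 1) = celestialShift sym j + lineSpan sym j - pointSpan sym j := by
  rw [celestialShift, List.take_add_one, List.map_append, List.sum_append, celestialShift, lineSpan,
    pointSpan, List.getD_eq_getElem _ _ hj, List.getElem?_eq_getElem hj, add_sub_assoc]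
  simp only [Option.toList_some, List.map_cons, List.map_nil, List.sum_singleton]

theorem stepCos_pos_of_span {s : ℤ} (hs : 0 < s ∧ 2 * s < m) : 0 < stepCos m s :=
  stepCos_pos hs.1.le hs.2

theorem sin_stepAngle_ne_zero_of_span {s : ℤ} (hs : 0 < s ∧ 2 * s < m) :
    sin (stepAngle m s) ≠ 0 := by
  rw [Ne, sin_stepAngle_eq_zero_iff (by omega)]
  intro hdvd
  have := Int.le_of_dvd hs.1 hdvd
  omega

theorem celestialRadius_pos (h : HasProperSpans m sym) (hj : j ≤ sym.length) :
    0 < celestialRadius m sym j := by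
  induction j with
  | zero => exact one_pos
  | succ j ih =>
    obtain ⟨hs, ht⟩ := h.of_lt_length hj
    exact div_pos (mul_pos (ih (by omega)) (stepCos_pos_of_span hs)) (stepCos_pos_of_span ht)

theorem vertex_eq_polarPoint (m : ℕ) (i : ℤ) :
    vertex m i = polarPoint 1 (π / 2 + stepAngle m (2 * i)) := by
  have hangle : π / 2 + 2 * π * i / m = π / 2 + stepAngle m (2 * i) := by
    rw [stepAngle]
    push_cast
    ring
  rw [vertex, polarPoint, hangle, one_mul, one_mul]

theorem polarPoint_sup_polarPoint_stepAngle {r : ℝ} (hr : r ≠ 0) {s : ℤ}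
    (hs : 0 < s ∧ 2 * s < m) (n : ℤ) :
    polarPoint r (π / 2 + stepAngle m n) ⊔ polarPoint r (π / 2 + stepAngle m (n + 2 * s)) =
      polarLine (r * stepCos m s) (π / 2 + stepAngle m (n + s)) := by
  rw [stepCos, ← polarPoint_sup_polarPoint hr (sin_stepAngle_ne_zero_of_span hs)]
  simp only [two_mul, stepAngle_add]
  ring_nf

theorem polarLine_inf_polarLine_stepAngle (d : ℝ) {t : ℤ} (ht : 0 < t ∧ 2 * t < m) (n : ℤ) :
    polarLine d (π / 2 + stepAngle m n) ⊓ polarLine d (π / 2 + stepAngle m (n - 2 * t)) =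
      polarPoint (d / stepCos m t) (π / 2 + stepAngle m (n - t)) := by
  rw [stepCos, ← polarLine_inf_polarLine (sin_stepAngle_ne_zero_of_span ht)
    (stepCos_pos_of_span ht).ne']
  simp only [two_mul, stepAngle_add, stepAngle_sub]
  ring_nf

theorem celestialPoint_succ (m : ℕ) (sym : List (ℤ × ℤ)) (j : ℕ) (i : ℤ) :
    celestialPoint m sym (j + 1) i =
      celestialLine m sym j i ⊓ celestialLine m sym j (i - pointSpan sym j) := rfl

theorem celestialLine_eq (m : ℕ) (sym : List (ℤ × ℤ)) (j : ℕ) (i : ℤ) :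
    celestialLine m sym j i =
      celestialPoint m sym j i ⊔ celestialPoint m sym j (i + lineSpan sym j) := rfl

theorem celestialLine_eq_polarLine_of_forall {r : ℝ} {n : ℤ} (hr : r ≠ 0)
    (hs : 0 < lineSpan sym j ∧ 2 * lineSpan sym j < m)
    (hpoint : ∀ i, celestialPoint m sym j i = polarPoint r (π / 2 + stepAngle m (2 * i + n)))
    (i : ℤ) :
    celestialLine m sym j i =
      polarLine (r * stepCos m (lineSpan sym j))
        (π / 2 + stepAngle m (2 * i + n + lineSpan sym j)) := by
  rw [celestialLine_eq, hpoint, hpoint, mul_add, add_right_comm,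
    polarPoint_sup_polarPoint_stepAngle hr hs]

theorem celestialPoint_eq_polarPoint (h : HasProperSpans m sym) (hj : j ≤ sym.length) (i : ℤ) :
    celestialPoint m sym j i =
      polarPoint (celestialRadius m sym j)
        (π / 2 + stepAngle m (2 * i + celestialShift sym j)) := by
  induction j generalizing i with
  | zero =>
    simp only [celestialPoint, vertex_eq_polarPoint, celestialRadius, celestialShift_zero, add_zero]
  | succ j ih =>
    obtain ⟨hs, ht⟩ := h.of_lt_length hj
    have hline := celestialLine_eq_polarLine_of_forall
      (celestialRadius_pos h (Nat.le_of_succ_le hj)).ne' hs (ih (Nat.le_of_succ_le hj))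
    rw [celestialPoint_succ, hline, hline, mul_sub, sub_add_eq_add_sub, sub_add_eq_add_sub,
      polarLine_inf_polarLine_stepAngle _ ht, celestialRadius, celestialShift_succ hj, add_assoc,
      add_sub_assoc]

theorem celestialLine_eq_polarLine (h : HasProperSpans m sym) (hj : j < sym.length) (i : ℤ) :
    celestialLine m sym j i =
      polarLine (celestialRadius m sym j * stepCos m (lineSpan sym j))
        (π / 2 + stepAngle m (2 * i + celestialShift sym j + lineSpan sym j)) :=
  celestialLine_eq_polarLine_of_forall (celestialRadius_pos h hj.le).ne' (h.of_lt_length hj).1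
    (celestialPoint_eq_polarPoint h hj.le) i

theorem celestialPoint_periodic (hm : m ≠ 0) (sym : List (ℤ × ℤ)) (j : ℕ) :
    Function.Periodic (celestialPoint m sym j) m := by
  induction j with
  | zero =>
    intro i
    have hangle : stepAngle m (2 * (i + m)) = stepAngle m (2 * i) + (1 : ℤ) * (2 * π) := by
      rw [← stepAngle_mul_period hm, ← stepAngle_add]
      ring_nf
    simp only [celestialPoint, vertex_eq_polarPoint, hangle, polarPoint, ← add_assoc,
      cos_add_int_mul_two_pi, sin_add_int_mul_two_pi]
  | succ j ih =>
    intro i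
    simp only [celestialPoint_succ, celestialLine_eq, add_sub_right_comm, add_right_comm,
      ih _]

theorem celestialLine_periodic (hm : m ≠ 0) (sym : List (ℤ × ℤ)) (j : ℕ) :
    Function.Periodic (celestialLine m sym j) m := fun i => by
  simp only [celestialLine_eq, add_right_comm i, celestialPoint_periodic hm sym j _]

theorem map_rotation_celestialPoint (h : HasProperSpans m sym) (hj : j ≤ sym.length) (i : ℤ) :
    (celestialPoint m sym j i).map (rotation (2 * π / m)) = celestialPoint m sym j (i + 1) := by
  rw [celestialPoint_eq_polarPoint h hj, celestialPoint_eq_polarPoint h hj,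
    map_rotation_polarPoint]
  congr 1
  simp only [stepAngle]
  push_cast
  ring

theorem map_rotation_celestialLine (h : HasProperSpans m sym) (hj : j < sym.length) (i : ℤ) :
    (celestialLine m sym j i).map (rotation (2 * π / m)) = celestialLine m sym j (i + 1) := by
  rw [celestialLine_eq, Submodule.map_sup, map_rotation_celestialPoint h hj.le,
    map_rotation_celestialPoint h hj.le, celestialLine_eq, add_right_comm]

theorem celestial_incidence (m : ℕ) (sym : List (ℤ × ℤ)) (j : ℕ) (i : ℤ) :
    celestialPoint m sym j i ≤ celestialLine m sym j i ∧
      celestialPoint m sym j (i + lineSpan sym j) ≤ celestialLine m sym j i ∧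
      celestialPoint m sym (j + 1) i ≤ celestialLine m sym j i ∧
      celestialPoint m sym (j + 1) (i + pointSpan sym j) ≤ celestialLine m sym j i := by
  refine ⟨le_sup_left, le_sup_right, inf_le_left, ?_⟩
  rw [celestialPoint_succ, add_sub_cancel_right]
  exact inf_le_right

theorem finrank_celestialPoint (h : HasProperSpans m sym) (hj : j ≤ sym.length) (i : ℤ) :
    Module.finrank ℝ (celestialPoint m sym j i) = 1 := by
  rw [celestialPoint_eq_polarPoint h hj]
  exact finrank_ordinaryPoint _ _

theorem finrank_celestialLine (h : HasProperSpans m sym) (hj : j < sym.length) (i : ℤ) :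
    Module.finrank ℝ (celestialLine m sym j i) = 2 := by
  rw [celestialLine_eq_polarLine h hj, finrank_polarLine]

theorem not_celestialPoint_le_lineAtInfinity (h : HasProperSpans m sym) (hj : j ≤ sym.length)
    (i : ℤ) : ¬ celestialPoint m sym j i ≤ lineAtInfinity := by
  rw [celestialPoint_eq_polarPoint h hj]
  exact not_ordinaryPoint_le_lineAtInfinity _ _

theorem celestialPoint_length_eq (h : HasProperSpans m sym)
    (hr : celestialRadius m sym sym.length = 1) {δ : ℤ}
    (hδ : celestialShift sym sym.length = 2 * δ) (i : ℤ) :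
    celestialPoint m sym sym.length i = celestialPoint m sym 0 (i + δ) := by
  rw [celestialPoint_eq_polarPoint h le_rfl, celestialPoint_eq_polarPoint h (Nat.zero_le _), hr,
    hδ, celestialRadius, celestialShift_zero, ← mul_add, add_zero]

theorem celestialPoint_le_celestialLine_iff (h : HasProperSpans m sym) (hk : k ≤ sym.length)
    (hj : j < sym.length) {b a : ℤ} :
    celestialPoint m sym k b ≤ celestialLine m sym j a ↔
      celestialRadius m sym k *
          stepCos m (2 * (b - a) + (celestialShift sym k - celestialShift sym j - lineSpan sym j)) =
        celestialRadius m sym j * stepCos m (lineSpan sym j) := by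
  rw [celestialPoint_eq_polarPoint h hk, celestialLine_eq_polarLine h hj,
    polarPoint_le_polarLine_iff, add_sub_add_left_eq_sub, ← stepAngle_sub, ← stepCos]
  ring_nf

theorem celestialPoint_le_celestialLine_self_iff (h : HasProperSpans m sym)
    (hj : j < sym.length) {b a : ℤ} :
    celestialPoint m sym j b ≤ celestialLine m sym j a ↔
      (m : ℤ) ∣ b - a ∨ (m : ℤ) ∣ b - a - lineSpan sym j := by
  have hm : m ≠ 0 := by have := h.of_lt_length hj; omega
  rw [celestialPoint_le_celestialLine_iff h hj.le hj,
    mul_right_inj' (celestialRadius_pos h hj.le).ne', sub_self, zero_sub, ← sub_eq_add_neg,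
    stepCos_two_mul_sub_eq_iff hm]

theorem celestialPoint_succ_le_celestialLine_iff (h : HasProperSpans m sym)
    (hj : j < sym.length) {b a : ℤ} :
    celestialPoint m sym (j + 1) b ≤ celestialLine m sym j a ↔
      (m : ℤ) ∣ b - a ∨ (m : ℤ) ∣ b - a - pointSpan sym j := by
  obtain ⟨hs, ht⟩ := h.of_lt_length hj
  have hdist : celestialRadius m sym (j + 1) * stepCos m (pointSpan sym j) =
      celestialRadius m sym j * stepCos m (lineSpan sym j) := by
    rw [celestialRadius, div_mul_cancel₀ _ (stepCos_pos_of_span ht).ne']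
  have hshift : celestialShift sym (j + 1) - celestialShift sym j - lineSpan sym j =
      -pointSpan sym j := by
    rw [celestialShift_succ hj]
    ring
  rw [celestialPoint_le_celestialLine_iff h hj hj, ← hdist, hshift,
    mul_right_inj' (celestialRadius_pos h hj).ne', ← sub_eq_add_neg,
    stepCos_two_mul_sub_eq_iff (by omega)]

theorem diameter_eq_polarLine (m : ℕ) (i : ℤ) :
    diameter m i = polarLine 0 (stepAngle m (2 * i)) := by
  rw [diameter, vertex_eq_polarPoint, polarPoint_sup_origin one_ne_zero]

theorem celestialPoint_le_diameter_iff (h : HasProperSpans m sym) (hm : m ≠ 0)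
    (hk : k ≤ sym.length) {b a : ℤ} :
    celestialPoint m sym k b ≤ diameter m a ↔ (m : ℤ) ∣ 2 * (b - a) + celestialShift sym k := by
  rw [celestialPoint_eq_polarPoint h hk, diameter_eq_polarLine, polarPoint_le_polarLine_iff,
    mul_eq_zero, or_iff_right (celestialRadius_pos h hk).ne', add_comm (π / 2), add_sub_right_comm,
    ← stepAngle_sub, cos_add_pi_div_two, neg_eq_zero, sin_stepAngle_eq_zero_iff hm]
  ring_nf

theorem pointAtInfinity_le_celestialLine_iff (h : HasProperSpans m sym) (hj : j < sym.length)
    {b a : ℤ} :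
    pointAtInfinity (stepAngle m (2 * b)) ≤ celestialLine m sym j a ↔
      (m : ℤ) ∣ 2 * (b - a) - (celestialShift sym j + lineSpan sym j) := by
  have hm : m ≠ 0 := by have := h.of_lt_length hj; omega
  rw [celestialLine_eq_polarLine h hj, pointAtInfinity_le_polarLine_iff, sub_add_eq_sub_sub_swap,
    ← stepAngle_sub, cos_sub_pi_div_two, sin_stepAngle_eq_zero_iff hm]
  ring_nf

end Celestial

/-! ### Admissible symbols -/

section Admissible

open scoped Pointwise

/-- The residues of `c` and `c + s` modulo `m`. -/
def voltagePair (m : ℕ) (c s : ℤ) : Finset (ZMod m) := {(c : ZMod m), ((c + s : ℤ) : ZMod m)}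

theorem intCast_mem_voltagePair {m : ℕ} {n c s : ℤ} :
    (n : ZMod m) ∈ voltagePair m c s ↔ (m : ℤ) ∣ n - c ∨ (m : ℤ) ∣ n - c - s := by
  rw [voltagePair, Finset.mem_insert, Finset.mem_singleton, eq_comm, @eq_comm _ (n : ZMod m),
    ZMod.intCast_eq_intCast_iff_dvd_sub, ZMod.intCast_eq_intCast_iff_dvd_sub, sub_add_eq_sub_sub]

theorem intCast_ne_zero_of_lt {m : ℕ} {s : ℤ} (hs : 0 < s) (hsm : s < m) : (s : ZMod m) ≠ 0 := by
  rw [Ne, ZMod.intCast_zmod_eq_zero_iff_dvd]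
  exact fun h => (Int.le_of_dvd hs h).not_gt hsm

theorem card_voltagePair {m : ℕ} {s : ℤ} (hs : 0 < s ∧ 2 * s < m) (c : ℤ) :
    (voltagePair m c s).card = 2 := by
  refine Finset.card_pair ?_
  rw [Int.cast_add, Ne, left_eq_add]
  exact intCast_ne_zero_of_lt hs.1 (by omega)

theorem nonempty_voltagePair (m : ℕ) (c s : ℤ) : (voltagePair m c s).Nonempty :=
  Finset.insert_nonempty _ _

theorem isAperiodic_voltagePair {m : ℕ} {s : ℤ} (hs : 0 < s ∧ 2 * s < m) (c : ℤ) :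
    IsAperiodic (voltagePair m c s) := by
  have hs0 := intCast_ne_zero_of_lt hs.1 (show s < m by omega)
  have h2s := intCast_ne_zero_of_lt (show 0 < s + s by omega) (show s + s < m by omega)
  rw [Int.cast_add] at h2s
  intro x hx
  simp only [voltagePair, Finset.mem_insert, Finset.mem_singleton, Int.cast_add] at hx
  rcases (hx c).1 (.inl rfl) with h | h
  · exact left_eq_add.1 h.symm
  · obtain rfl := add_left_cancel h
    rcases (hx (c + s)).1 (.inr rfl) with h | h
    · exact absurd (left_eq_add.1 (add_assoc (c : ZMod m) s s ▸ h).symm) h2s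
    · exact absurd (left_eq_add.1 h.symm) hs0

/-- The symbol is admissible with twist `δ`: the construction does not degenerate, it closes up
after its last step, and a line passes through no further points than those required. The last
condition is stated in the polar coordinates of `celestialPoint_le_celestialLine_iff`. -/
structure IsAdmissible (m : ℕ) (sym : List (ℤ × ℤ)) (δ : ℤ) : Prop where
  proper : HasProperSpans m sym
  radius_length : celestialRadius m sym sym.length = 1
  shift_length : celestialShift sym sym.length = 2 * δ
  no_accidental_incidence : ∀ k < sym.length, ∀ j < sym.length, k ≠ j → k ≠ (j + 1) % sym.length →
    ∀ n, 2 ∣ n - (celestialShift sym k - celestialShift sym j - lineSpan sym j) →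
      celestialRadius m sym k * stepCos m n ≠ celestialRadius m sym j * stepCos m (lineSpan sym j)

/-- The voltage table of the celestial configuration with twist `δ`. Its last class of points,
`(v_h)_i`, is identified with class `0`, which shifts the voltages there by `δ`. -/
def celestialVoltage (m : ℕ) (sym : List (ℤ × ℤ)) (δ : ℤ) :
    Fin sym.length → Fin sym.length → Finset (ZMod m) :=
  permVoltage (finRotate sym.length) (fun j => voltagePair m 0 (lineSpan sym j))
    fun j => voltagePair m (if (j : ℕ) + 1 = sym.length then δ else 0) (pointSpan sym j)

theorem val_finRotate {h : ℕ} (j : Fin h) : (finRotate h j : ℕ) = (j + 1) % h := by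
  have := j.neZero
  rw [finRotate_apply, Fin.val_add, Fin.val_one', Nat.add_mod_mod]

theorem finRotate_ne_self {h : ℕ} (hh : 2 ≤ h) (j : Fin h) : finRotate h j ≠ j := by
  rw [Ne, Fin.ext_iff, val_finRotate]
  rcases eq_or_ne ((j : ℕ) + 1) h with hj | hj
  · rw [hj, Nat.mod_self]
    omega
  · rw [Nat.mod_eq_of_lt (by omega)]
    omega

theorem finRotate_finRotate_ne_self {h : ℕ} (hh : 3 ≤ h) (j : Fin h) :
    finRotate h (finRotate h j) ≠ j := by
  rw [Ne, Fin.ext_iff, val_finRotate, val_finRotate, Nat.mod_add_mod]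
  rcases lt_or_ge ((j : ℕ) + 1 + 1) h with hj | hj
  · rw [Nat.mod_eq_of_lt hj]
    omega
  · rw [Nat.mod_eq_sub_mod hj, Nat.mod_eq_of_lt (by omega)]
    omega

variable {m : ℕ} {sym : List (ℤ × ℤ)} {δ : ℤ}

theorem celestialPoints_eq_range (m : ℕ) (sym : List (ℤ × ℤ)) :
    celestialPoints m sym =
      Set.range (Function.uncurry fun k : Fin sym.length => celestialPoint m sym k) := by
  ext p
  simp only [celestialPoints, Set.mem_ofPred_eq, Set.mem_range, Prod.exists, Fin.exists_iff,
    Function.uncurry_apply_pair, exists_prop, eq_comm]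

theorem celestialLines_eq_range (m : ℕ) (sym : List (ℤ × ℤ)) :
    celestialLines m sym =
      Set.range (Function.uncurry fun j : Fin sym.length => celestialLine m sym j) := by
  ext l
  simp only [celestialLines, Set.mem_ofPred_eq, Set.mem_range, Prod.exists, Fin.exists_iff,
    Function.uncurry_apply_pair, exists_prop, eq_comm]

namespace IsAdmissible

theorem celestialPoint_length (h : IsAdmissible m sym δ) (i : ℤ) :
    celestialPoint m sym sym.length i = celestialPoint m sym 0 (i + δ) :=
  celestialPoint_length_eq h.proper h.radius_length h.shift_length i

theorem ne_zero (h : IsAdmissible m sym δ) (hsym : sym ≠ []) : m ≠ 0 := by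
  have := h.proper.of_lt_length (List.length_pos_iff.2 hsym)
  omega

theorem celestialPoint_add_one_mod (h : IsAdmissible m sym δ) {j : ℕ} (hj : j < sym.length)
    (i : ℤ) : celestialPoint m sym ((j + 1) % sym.length) i =
      celestialPoint m sym (j + 1) (i - if j + 1 = sym.length then δ else 0) := by
  split_ifs with hlast
  · rw [hlast, Nat.mod_self, h.celestialPoint_length, sub_add_cancel]
  · rw [Nat.mod_eq_of_lt (by omega), sub_zero]

theorem celestialPoint_le_celestialLine_iff_mem (h : IsAdmissible m sym δ)
    (k j : Fin sym.length) (b a : ℤ) :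
    celestialPoint m sym k b ≤ celestialLine m sym j a ↔
      ((b - a : ℤ) : ZMod m) ∈ celestialVoltage m sym δ k j := by
  rw [celestialVoltage, permVoltage]
  obtain hkj | hkj := eq_or_ne k j
  · rw [if_pos hkj, hkj, celestialPoint_le_celestialLine_self_iff h.proper j.2,
      intCast_mem_voltagePair, sub_zero]
  obtain hkσ | hkσ := eq_or_ne k (finRotate sym.length j)
  · rw [if_neg hkj, if_pos hkσ, hkσ, val_finRotate, h.celestialPoint_add_one_mod j.2,
      celestialPoint_succ_le_celestialLine_iff h.proper j.2, intCast_mem_voltagePair,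
      sub_right_comm b]
  · rw [if_neg hkj, if_neg hkσ, celestialPoint_le_celestialLine_iff h.proper k.2.le j.2]
    rw [Ne, Fin.ext_iff, val_finRotate] at hkσ
    exact iff_of_false (h.no_accidental_incidence k k.2 j j.2 (Fin.val_ne_of_ne hkj) hkσ _
      (by omega)) (Finset.notMem_empty _)

theorem rowsSeparated_celestialVoltage (h : IsAdmissible m sym δ) (hlen : 3 ≤ sym.length) :
    RowsSeparated (celestialVoltage m sym δ) :=
  rowsSeparated_permVoltage (finRotate_finRotate_ne_self hlen)
    (fun _ => nonempty_voltagePair _ _ _) (fun _ => nonempty_voltagePair _ _ _)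
    fun j => isAperiodic_voltagePair (h.proper.of_lt_length j.2).1 _

theorem columnsSeparated_celestialVoltage (h : IsAdmissible m sym δ) (hlen : 3 ≤ sym.length) :
    RowsSeparated fun j k => -celestialVoltage m sym δ k j :=
  columnsSeparated_permVoltage (finRotate_finRotate_ne_self hlen)
    (fun _ => nonempty_voltagePair _ _ _) (fun _ => nonempty_voltagePair _ _ _)
    fun j => isAperiodic_voltagePair (h.proper.of_lt_length j.2).1 _

theorem sum_card_celestialVoltage_column (h : IsAdmissible m sym δ) (hlen : 2 ≤ sym.length)
    (j : Fin sym.length) : ∑ k, (celestialVoltage m sym δ k j).card = 4 := by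
  unfold celestialVoltage
  rw [sum_card_permVoltage_column (finRotate_ne_self hlen),
    card_voltagePair (h.proper.of_lt_length j.2).1, card_voltagePair (h.proper.of_lt_length j.2).2]

theorem sum_card_celestialVoltage_row (h : IsAdmissible m sym δ) (hlen : 2 ≤ sym.length)
    (k : Fin sym.length) : ∑ j, (celestialVoltage m sym δ k j).card = 4 := by
  unfold celestialVoltage
  rw [sum_card_permVoltage_row (finRotate_ne_self hlen),
    card_voltagePair (h.proper.of_lt_length k.2).1, card_voltagePair (h.proper.of_lt_length _).2]
  exact ((finRotate _).symm k).2

theorem isConfiguration (h : IsAdmissible m sym δ) (hlen : 3 ≤ sym.length) :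
    IsConfiguration (· ≤ ·) (m * sym.length) 4 (celestialPoints m sym) (celestialLines m sym) := by
  have hm : m ≠ 0 := h.ne_zero (List.ne_nil_of_length_pos (by omega))
  have : NeZero m := ⟨hm⟩
  rw [celestialPoints_eq_range, celestialLines_eq_range, mul_comm]
  simpa only [Fintype.card_fin] using
    isConfiguration_of_periodic (fun k : Fin sym.length => celestialPoint_periodic hm sym k)
      (fun j : Fin sym.length => celestialLine_periodic hm sym j)
      h.celestialPoint_le_celestialLine_iff_mem (h.rowsSeparated_celestialVoltage hlen)
      (h.columnsSeparated_celestialVoltage hlen) rfl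
      (h.sum_card_celestialVoltage_column (by omega)) (h.sum_card_celestialVoltage_row (by omega))

theorem isCelestial (h : IsAdmissible m sym δ) (hlen : 3 ≤ sym.length) : IsCelestial m sym where
  config := by
    refine ⟨?_, ?_, h.isConfiguration hlen⟩
    · rintro _ ⟨k, hk, i, rfl⟩
      exact finrank_celestialPoint h.proper hk.le i
    · rintro _ ⟨j, hj, i, rfl⟩
      exact finrank_celestialLine h.proper hj i
  ordinary := by
    rintro _ ⟨k, hk, i, rfl⟩
    exact not_celestialPoint_le_lineAtInfinity h.proper hk.le i
  rotate_point _ hj := map_rotation_celestialPoint h.proper hj.le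
  rotate_line _ hj := map_rotation_celestialLine h.proper hj
  incidence j _ := celestial_incidence m sym j
  closing := by
    refine ⟨δ, ?_, h.celestialPoint_length⟩
    rw [← h.shift_length, celestialShift, List.take_length]

end IsAdmissible

end Admissible

/-! ### Cosine inequalities -/

section Cosines

variable {m : ℕ} {a b c d n : ℤ}

theorem stepCos_mul_lt_mul_of_add_eq (hsum : a + b = c + d) (hcd : 0 ≤ c - d)
    (hlt : c - d < a - b) (hm : a - b ≤ m) :
    stepCos m a * stepCos m b < stepCos m c * stepCos m d := by
  rw [stepCos_mul, stepCos_mul, hsum]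
  have := stepCos_strictAntiOn m ⟨hcd, by omega⟩ ⟨by omega, hm⟩ hlt
  linarith

theorem stepCos_mul_lt_mul_of_sub_eq (hdiff : a - b = c - d) (hcd : 0 ≤ c + d)
    (hlt : c + d < a + b) (hm : a + b ≤ m) :
    stepCos m a * stepCos m b < stepCos m c * stepCos m d := by
  rw [stepCos_mul, stepCos_mul, hdiff]
  have := stepCos_strictAntiOn m ⟨hcd, by omega⟩ ⟨by omega, hm⟩ hlt
  linarith

theorem stepCos_mul_ne_succ_mul_pred (hb : 0 ≤ b) (hba : b ≤ a) (hm : a + b + 2 ≤ m)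
    (hn : 2 ∣ n - a) : stepCos m b * stepCos m n ≠ stepCos m (a + 1) * stepCos m (b - 1) := by
  refine mul_stepCos_ne_of_between (hb.trans hba) (by omega) hn (stepCos_pos hb (by omega)) ?_ ?_
  · rw [mul_comm]
    exact stepCos_mul_lt_mul_of_sub_eq (by ring) (by omega) (by omega) (by omega)
  · rw [mul_comm (stepCos m b)]
    exact stepCos_mul_lt_mul_of_add_eq (by ring) (by omega) (by omega) (by omega)

theorem stepCos_mul_ne_succ_mul_succ (hb : 0 ≤ b) (hba : b ≤ a) (hm : a + b + 2 ≤ m)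
    (hn : 2 ∣ n - a) : stepCos m b * stepCos m n ≠ stepCos m (a + 1) * stepCos m (b + 1) := by
  refine mul_stepCos_ne_of_between (hb.trans hba) (by omega) hn (stepCos_pos hb (by omega)) ?_ ?_
  · rw [mul_comm]
    exact stepCos_mul_lt_mul_of_add_eq (by ring) (by omega) (by omega) (by omega)
  · rw [mul_comm (stepCos m b)]
    exact stepCos_mul_lt_mul_of_sub_eq (by ring) (by omega) (by omega) (by omega)

theorem stepCos_mul_mul (m : ℕ) (a b c : ℤ) :
    stepCos m a * stepCos m b * stepCos m c = (stepCos m (a + b + c) + stepCos m (a + b - c) +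
      stepCos m (a - b + c) + stepCos m (a - b - c)) / 4 := by
  rw [stepCos_mul, div_mul_eq_mul_div, add_mul, stepCos_mul, stepCos_mul]
  ring

theorem stepCos_one_mul_three_mul_seven_lt (hm : 9 ≤ m) :
    stepCos m 1 * stepCos m 3 * stepCos m 7 < stepCos m 2 * stepCos m 4 * stepCos m 5 := by
  have h97 := stepCos_strictAntiOn m (a := 7) (b := 9) ⟨by omega, by omega⟩ ⟨by omega, by omega⟩
    (by omega)
  have h51 := stepCos_strictAntiOn m (a := 1) (b := 5) ⟨by omega, by omega⟩ ⟨by omega, by omega⟩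
    (by omega)
  rw [stepCos_mul_mul, stepCos_mul_mul]
  norm_num [stepCos_neg]
  linarith

theorem stepCos_five_lt_four_mul_one (hm : 5 ≤ m) :
    stepCos m 5 < stepCos m 4 * stepCos m 1 := by
  have h53 := stepCos_strictAntiOn m (a := 3) (b := 5) ⟨by omega, by omega⟩ ⟨by omega, by omega⟩
    (by omega)
  have := stepCos_mul m 4 1
  norm_num at this
  linarith

theorem stepCos_five_mul_two_lt (hm : 7 ≤ m) :
    stepCos m 5 * stepCos m 2 < stepCos m 4 * stepCos m 1 * stepCos m 3 := by
  have h1 : 0 < stepCos m 1 := stepCos_pos (by omega) (by omega)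
  have h10 : stepCos m 1 < 1 := by
    rw [← stepCos_zero m]
    exact stepCos_strictAntiOn m ⟨by omega, by omega⟩ ⟨by omega, by omega⟩ (by omega)
  have h71 := stepCos_strictAntiOn m (a := 1) (b := 7) ⟨by omega, by omega⟩ ⟨by omega, by omega⟩
    (by omega)
  have hdiff : 4 * (stepCos m 4 * stepCos m 1 * stepCos m 3 - stepCos m 5 * stepCos m 2) =
      2 * (1 - stepCos m 1) * (stepCos m 1 * (3 + 4 * stepCos m 1) - stepCos m 7) := by
    have h413 := stepCos_mul_mul m 4 1 3
    have h52 := stepCos_mul m 5 2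
    have h71 := stepCos_mul m 7 1
    have h11 := stepCos_mul m 1 1
    have h111 := stepCos_mul_mul m 1 1 1
    norm_num [stepCos_neg, stepCos_zero] at h413 h52 h71 h11 h111
    linear_combination 4 * h413 - 4 * h52 - 2 * h71 - 2 * h11 + 8 * h111
  have hpos : 0 < 2 * (1 - stepCos m 1) * (stepCos m 1 * (3 + 4 * stepCos m 1) - stepCos m 7) :=
    mul_pos (by linarith) (by nlinarith)
  linarith

end Cosines

/-! ### The symbol `(5,1;2,3;4,5;1,2;3,4)` -/

section SymbolD5

variable {m : ℕ} (n : ℤ)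

theorem hasProperSpans_symbolD5 (hm : 11 ≤ m) : HasProperSpans m symbolD5 := by
  intro a ha
  simp only [symbolD5, List.mem_cons, List.not_mem_nil, or_false] at ha
  rcases ha with rfl | rfl | rfl | rfl | rfl <;> simp only <;> omega

theorem stepCos_ne_zero_of_le_five (hm : 11 ≤ m) :
    stepCos m 1 ≠ 0 ∧ stepCos m 2 ≠ 0 ∧ stepCos m 3 ≠ 0 ∧ stepCos m 4 ≠ 0 ∧ stepCos m 5 ≠ 0 := by
  refine ⟨?_, ?_, ?_, ?_, ?_⟩ <;> exact (stepCos_pos (by omega) (by omega)).ne'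

theorem celestialRadius_symbolD5 (hm : 11 ≤ m) :
    celestialRadius m symbolD5 0 = 1 ∧
    celestialRadius m symbolD5 1 = stepCos m 5 / stepCos m 1 ∧
    celestialRadius m symbolD5 2 = stepCos m 5 * stepCos m 2 / (stepCos m 1 * stepCos m 3) ∧
    celestialRadius m symbolD5 3 = stepCos m 2 * stepCos m 4 / (stepCos m 1 * stepCos m 3) ∧
    celestialRadius m symbolD5 4 = stepCos m 4 / stepCos m 3 ∧
    celestialRadius m symbolD5 5 = 1 := by
  obtain ⟨h1, h2, h3, h4, h5⟩ := stepCos_ne_zero_of_le_five hm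
  simp only [celestialRadius, lineSpan, pointSpan, symbolD5, List.getD_cons_zero,
    List.getD_cons_succ]
  refine ⟨trivial, ?_, ?_, ?_, ?_, ?_⟩ <;> field_simp

theorem one_mul_stepCos_ne (hm : 11 ≤ m) (hn : 2 ∣ n - 4) :
    stepCos m 1 * stepCos m n ≠ stepCos m 5 * stepCos m 2 :=
  stepCos_mul_ne_succ_mul_succ (a := 4) (b := 1) (by omega) (by omega) (by omega) hn

theorem two_mul_stepCos_ne (hm : 11 ≤ m) (hn : 2 ∣ n - 2) :
    stepCos m 2 * stepCos m n ≠ stepCos m 3 * stepCos m 1 :=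
  stepCos_mul_ne_succ_mul_pred (a := 2) (b := 2) (by omega) (by omega) (by omega) hn

theorem three_mul_stepCos_ne (hm : 11 ≤ m) (hn : 2 ∣ n - 3) :
    stepCos m 3 * stepCos m n ≠ stepCos m 4 * stepCos m 2 :=
  stepCos_mul_ne_succ_mul_pred (a := 3) (b := 3) (by omega) (by omega) (by omega) hn

theorem four_mul_stepCos_ne (hm : 11 ≤ m) (hn : 2 ∣ n - 4) :
    stepCos m 4 * stepCos m n ≠ stepCos m 5 * stepCos m 3 :=
  stepCos_mul_ne_succ_mul_pred (a := 4) (b := 4) (by omega) (by omega) (by omega) hn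

theorem one_mul_three_mul_stepCos_ne (hm : 11 ≤ m) (hn : 2 ∣ n - 5) :
    stepCos m 1 * stepCos m 3 * stepCos m n ≠ stepCos m 2 * stepCos m 4 * stepCos m 5 := by
  have h1 : 0 < stepCos m 1 := stepCos_pos (by omega) (by omega)
  have h3 : 0 < stepCos m 3 := stepCos_pos (by omega) (by omega)
  have h5 : 0 < stepCos m 5 := stepCos_pos (by omega) (by omega)
  have h4231 : stepCos m 4 * stepCos m 2 < stepCos m 3 * stepCos m 1 :=
    stepCos_mul_lt_mul_of_sub_eq (by omega) (by omega) (by omega) (by omega)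
  refine mul_stepCos_ne_of_between (by omega) (by omega) hn (mul_pos h1 h3)
    (stepCos_one_mul_three_mul_seven_lt (by omega)) ?_
  gcongr ?_ * _
  linarith

theorem two_mul_four_mul_stepCos_ne (hm : 11 ≤ m) (hn : 2 ∣ n - 3) :
    stepCos m 2 * stepCos m 4 * stepCos m n ≠ stepCos m 1 * stepCos m 3 * stepCos m 5 := by
  have h2 : 0 < stepCos m 2 := stepCos_pos (by omega) (by omega)
  have h3 : 0 < stepCos m 3 := stepCos_pos (by omega) (by omega)
  have h4 : 0 < stepCos m 4 := stepCos_pos (by omega) (by omega)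
  have h5 : 0 < stepCos m 5 := stepCos_pos (by omega) (by omega)
  have h4231 : stepCos m 4 * stepCos m 2 < stepCos m 3 * stepCos m 1 :=
    stepCos_mul_lt_mul_of_sub_eq (by omega) (by omega) (by omega) (by omega)
  have h5142 : stepCos m 5 * stepCos m 1 < stepCos m 4 * stepCos m 2 :=
    stepCos_mul_lt_mul_of_add_eq (by omega) (by omega) (by omega) (by omega)
  refine mul_stepCos_ne_of_between (by omega) (by omega) hn (mul_pos h2 h4) ?_ ?_
  · norm_num
    nlinarith
  · nlinarith

theorem one_mul_four_mul_stepCos_ne (hm : 11 ≤ m) (hn : 2 ∣ n - 3) :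
    stepCos m 1 * stepCos m 4 * stepCos m n ≠ stepCos m 2 * stepCos m 3 * stepCos m 5 := by
  have h1 : 0 < stepCos m 1 := stepCos_pos (by omega) (by omega)
  have h3 : 0 < stepCos m 3 := stepCos_pos (by omega) (by omega)
  have h4 : 0 < stepCos m 4 := stepCos_pos (by omega) (by omega)
  have h5 : 0 < stepCos m 5 := stepCos_pos (by omega) (by omega)
  have h4132 : stepCos m 4 * stepCos m 1 < stepCos m 3 * stepCos m 2 :=
    stepCos_mul_lt_mul_of_add_eq (by omega) (by omega) (by omega) (by omega)
  have h5241 : stepCos m 5 * stepCos m 2 < stepCos m 4 * stepCos m 1 :=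
    stepCos_mul_lt_mul_of_sub_eq (by omega) (by omega) (by omega) (by omega)
  refine mul_stepCos_ne_of_between (by omega) (by omega) hn (mul_pos h1 h4) ?_ ?_
  · norm_num
    nlinarith
  · nlinarith

theorem five_mul_stepCos_ne (hm : 11 ≤ m) :
    stepCos m 5 * stepCos m n ≠ stepCos m 4 * stepCos m 1 :=
  mul_stepCos_ne_of_lt (stepCos_pos (by omega) (by omega)).le
    (stepCos_five_lt_four_mul_one (by omega)) n

theorem five_mul_three_mul_stepCos_ne (hm : 11 ≤ m) :
    stepCos m 5 * stepCos m 3 * stepCos m n ≠ stepCos m 4 * stepCos m 1 * stepCos m 2 := by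
  have h3 : 0 < stepCos m 3 := stepCos_pos (by omega) (by omega)
  have h5 : 0 < stepCos m 5 := stepCos_pos (by omega) (by omega)
  have h32 : stepCos m 3 < stepCos m 2 :=
    stepCos_strictAntiOn m ⟨by omega, by omega⟩ ⟨by omega, by omega⟩ (by omega)
  exact mul_stepCos_ne_of_lt (mul_pos h5 h3).le
    (mul_lt_mul'' (stepCos_five_lt_four_mul_one (by omega)) h32 h5.le h3.le) n

theorem five_mul_two_mul_stepCos_ne (hm : 11 ≤ m) :
    stepCos m 5 * stepCos m 2 * stepCos m n ≠ stepCos m 4 * stepCos m 1 * stepCos m 3 :=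
  mul_stepCos_ne_of_lt (mul_pos (stepCos_pos (by omega) (by omega))
    (stepCos_pos (by omega) (by omega))).le (stepCos_five_mul_two_lt (by omega)) n

theorem celestialShift_symbolD5 :
    celestialShift symbolD5 0 = 0 ∧ celestialShift symbolD5 1 = 4 ∧
    celestialShift symbolD5 2 = 3 ∧ celestialShift symbolD5 3 = 2 ∧
    celestialShift symbolD5 4 = 1 ∧ celestialShift symbolD5 5 = 0 := by
  decide

theorem lineSpan_symbolD5 :
    lineSpan symbolD5 0 = 5 ∧ lineSpan symbolD5 1 = 2 ∧ lineSpan symbolD5 2 = 4 ∧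
    lineSpan symbolD5 3 = 1 ∧ lineSpan symbolD5 4 = 3 := by
  decide

theorem symbolD5_no_accidental_incidence (hm : 11 ≤ m) {k j : ℕ} (hk : k < 5) (hj : j < 5)
    (hkj : k ≠ j) (hkj' : k ≠ (j + 1) % 5)
    (hn : 2 ∣ n - (celestialShift symbolD5 k - celestialShift symbolD5 j - lineSpan symbolD5 j)) :
    celestialRadius m symbolD5 k * stepCos m n ≠
      celestialRadius m symbolD5 j * stepCos m (lineSpan symbolD5 j) := by
  obtain ⟨h1, h2, h3, h4, h5⟩ := stepCos_ne_zero_of_le_five hm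
  obtain ⟨r0, r1, r2, r3, r4, -⟩ := celestialRadius_symbolD5 hm
  obtain ⟨s0, s1, s2, s3, s4, -⟩ := celestialShift_symbolD5
  obtain ⟨l0, l1, l2, l3, l4⟩ := lineSpan_symbolD5
  intro h
  have hcases : (k = 0 ∧ (j = 1 ∨ j = 2 ∨ j = 3)) ∨ (k = 1 ∧ (j = 2 ∨ j = 3 ∨ j = 4)) ∨
      (k = 2 ∧ (j = 0 ∨ j = 3 ∨ j = 4)) ∨ (k = 3 ∧ (j = 0 ∨ j = 1 ∨ j = 4)) ∨
      (k = 4 ∧ (j = 0 ∨ j = 1 ∨ j = 2)) := by clear hn h; omega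
  rcases hcases with ⟨rfl, rfl | rfl | rfl⟩ | ⟨rfl, rfl | rfl | rfl⟩ | ⟨rfl, rfl | rfl | rfl⟩ |
    ⟨rfl, rfl | rfl | rfl⟩ | ⟨rfl, rfl | rfl | rfl⟩
  all_goals
    simp only [s0, s1, s2, s3, s4, l0, l1, l2, l3, l4] at hn
    simp only [r0, r1, r2, r3, r4, l0, l1, l2, l3, l4] at h
    field_simp at h
  · exact one_mul_stepCos_ne n hm (by omega) (by linear_combination h)
  · exact one_mul_three_mul_stepCos_ne n hm (by omega) (by linear_combination h)
  · exact three_mul_stepCos_ne n hm (by omega) (by linear_combination h)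
  · exact three_mul_stepCos_ne n hm (by omega) (by linear_combination h)
  · exact five_mul_three_mul_stepCos_ne n hm (by linear_combination h)
  · exact five_mul_stepCos_ne n hm (by linear_combination h)
  · exact two_mul_stepCos_ne n hm (by omega) (by linear_combination h)
  · exact five_mul_stepCos_ne n hm (by linear_combination h)
  · exact five_mul_two_mul_stepCos_ne n hm (by linear_combination h)
  · exact two_mul_four_mul_stepCos_ne n hm (by omega) (by linear_combination h)
  · exact four_mul_stepCos_ne n hm (by omega) (by linear_combination h)
  · exact two_mul_stepCos_ne n hm (by omega) (by linear_combination h)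
  · exact four_mul_stepCos_ne n hm (by omega) (by linear_combination h)
  · exact one_mul_four_mul_stepCos_ne n hm (by omega) (by linear_combination h)
  · exact one_mul_stepCos_ne n hm (by omega) (by linear_combination h)

theorem isAdmissible_symbolD5 (hm : 11 ≤ m) : IsAdmissible m symbolD5 0 where
  proper := hasProperSpans_symbolD5 hm
  radius_length := (celestialRadius_symbolD5 hm).2.2.2.2.2
  shift_length := celestialShift_symbolD5.2.2.2.2.2
  no_accidental_incidence _ hk _ hj hkj hkj' n hn :=
    symbolD5_no_accidental_incidence n hm hk hj hkj hkj' hn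

end SymbolD5

/-! ### Adjoining the diameters and the points at infinity -/

section Adjoin

open scoped Pointwise

variable {m : ℕ} {sym : List (ℤ × ℤ)} {δ : ℤ}

theorem stepCos_two_mul_ne_zero (hodd : Odd m) (n : ℤ) : stepCos m (2 * n) ≠ 0 := by
  have hm : m ≠ 0 := hodd.pos.ne'
  intro hcos
  have hsin : sin (stepAngle m (2 * n + 2 * n)) = 0 := by
    rw [stepAngle_add, sin_add, show cos (stepAngle m (2 * n)) = 0 from hcos, mul_zero, zero_mul,
      add_zero]
  have hdvd : (m : ℤ) ∣ n := by
    rw [sin_stepAngle_eq_zero_iff hm, ← mul_add, ← two_mul] at hsin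
    have hcop : IsCoprime (m : ℤ) 2 := (Nat.coprime_two_right.2 hodd).isCoprime
    exact hcop.dvd_of_dvd_mul_left (hcop.dvd_of_dvd_mul_left hsin)
  obtain ⟨k, rfl⟩ := hdvd
  have hone : stepCos m (2 * (m * k)) = 1 := by
    rw [← mul_assoc, ← zero_add (2 * (m : ℤ) * k), stepCos_add_period hm, stepCos_zero]
  exact one_ne_zero (hone.symm.trans hcos)

theorem natCast_dvd_two_mul_sub_iff (hodd : Odd m) (n c : ℤ) :
    (m : ℤ) ∣ 2 * n - c ↔ (n : ZMod m) = c * 2⁻¹ := by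
  have htwo : (2 : ZMod m) * 2⁻¹ = 1 := by
    exact_mod_cast ZMod.coe_mul_inv_eq_one 2 (Nat.coprime_two_left.2 hodd)
  rw [← ZMod.intCast_zmod_eq_zero_iff_dvd]
  push_cast
  constructor
  · intro h
    linear_combination (2 : ZMod m)⁻¹ * h - (n : ZMod m) * htwo
  · intro h
    linear_combination 2 * h + (c : ZMod m) * htwo

theorem diameter_periodic (hm : m ≠ 0) : Function.Periodic (diameter m) m := fun i => by
  simp only [diameter, show vertex m (i + m) = vertex m i from celestialPoint_periodic hm [] 0 i]

theorem finrank_diameter (m : ℕ) (i : ℤ) : Module.finrank ℝ (diameter m i) = 2 := by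
  rw [diameter_eq_polarLine, finrank_polarLine]

theorem not_pointAtInfinity_le_diameter (hodd : Odd m) (b a : ℤ) :
    ¬ pointAtInfinity (stepAngle m (2 * b)) ≤ diameter m a := by
  rw [diameter_eq_polarLine, pointAtInfinity_le_polarLine_iff, ← stepAngle_sub, ← mul_sub]
  exact stepCos_two_mul_ne_zero hodd _

/-- The points at infinity of `D₅`, as a sequence of period `m`. -/
def farPoint (m : ℕ) (i : ℤ) : Flat := pointAtInfinity (stepAngle m (2 * i))

theorem farPoint_periodic (hm : m ≠ 0) : Function.Periodic (farPoint m) m := fun i => by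
  have hangle : stepAngle m (2 * (i + m)) = stepAngle m (2 * i) + (1 : ℤ) * (2 * π) := by
    rw [← stepAngle_mul_period hm, ← stepAngle_add]
    ring_nf
  simp only [farPoint, hangle, pointAtInfinity, cos_add_int_mul_two_pi, sin_add_int_mul_two_pi]

/-- The classes of points of the celestial configuration, with the points at infinity as a further
class `none`. -/
def adjoinedPoint (m : ℕ) (sym : List (ℤ × ℤ)) : Option (Fin sym.length) → ℤ → Flat
  | some k => celestialPoint m sym k
  | none => farPoint m

/-- The classes of lines of the celestial configuration, with the diameters as a further class
`none`. -/
def adjoinedLine (m : ℕ) (sym : List (ℤ × ℤ)) : Option (Fin sym.length) → ℤ → Flat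
  | some j => celestialLine m sym j
  | none => diameter m

/-- The voltage table of `adjoinedPoint` and `adjoinedLine` for odd `m`, where `2` is invertible
modulo `m`. -/
def adjoinedVoltage (m : ℕ) (sym : List (ℤ × ℤ)) (δ : ℤ) :
    Option (Fin sym.length) → Option (Fin sym.length) → Finset (ZMod m)
  | some k, some j => celestialVoltage m sym δ k j
  | some k, none => {((-celestialShift sym k : ℤ) : ZMod m) * 2⁻¹}
  | none, some j => {((celestialShift sym j + lineSpan sym j : ℤ) : ZMod m) * 2⁻¹}
  | none, none => ∅

theorem range_uncurry_option {C P : Type*} (f : Option C → ℤ → P) :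
    Set.range (Function.uncurry f) =
      Set.range (Function.uncurry fun k => f (some k)) ∪ Set.range (f none) := by
  ext x
  simp only [Set.mem_range, Set.mem_union, Prod.exists, Option.exists, Function.uncurry_apply_pair,
    or_comm]

theorem range_adjoinedPoint (m : ℕ) (sym : List (ℤ × ℤ)) :
    Set.range (Function.uncurry (adjoinedPoint m sym)) =
      celestialPoints m sym ∪ Set.range (farPoint m) := by
  rw [range_uncurry_option, celestialPoints_eq_range]
  rfl

theorem range_adjoinedLine (m : ℕ) (sym : List (ℤ × ℤ)) :
    Set.range (Function.uncurry (adjoinedLine m sym)) =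
      celestialLines m sym ∪ Set.range (diameter m) := by
  rw [range_uncurry_option, celestialLines_eq_range]
  rfl

namespace IsAdmissible

theorem adjoinedPoint_le_adjoinedLine_iff_mem (h : IsAdmissible m sym δ) (hodd : Odd m)
    (k j : Option (Fin sym.length)) (b a : ℤ) :
    adjoinedPoint m sym k b ≤ adjoinedLine m sym j a ↔
      ((b - a : ℤ) : ZMod m) ∈ adjoinedVoltage m sym δ k j := by
  rcases k with _ | k <;> rcases j with _ | j
  · exact iff_of_false (not_pointAtInfinity_le_diameter hodd b a) (Finset.notMem_empty _)
  · rw [adjoinedVoltage, Finset.mem_singleton, ← natCast_dvd_two_mul_sub_iff hodd]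
    exact pointAtInfinity_le_celestialLine_iff h.proper j.2
  · rw [adjoinedVoltage, Finset.mem_singleton, ← natCast_dvd_two_mul_sub_iff hodd, sub_neg_eq_add]
    exact celestialPoint_le_diameter_iff h.proper hodd.pos.ne' k.2.le
  · exact h.celestialPoint_le_celestialLine_iff_mem k j b a

theorem rowsSeparated_adjoinedVoltage (h : IsAdmissible m sym δ) (hlen : 3 ≤ sym.length) :
    RowsSeparated (adjoinedVoltage m sym δ) :=
  rowsSeparated_option (h.rowsSeparated_celestialVoltage hlen) rfl
    (fun _ => Finset.singleton_nonempty _) (j₀ := ⟨0, by omega⟩) (isAperiodic_singleton _)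

theorem columnsSeparated_adjoinedVoltage (h : IsAdmissible m sym δ) (hlen : 3 ≤ sym.length) :
    RowsSeparated fun j k => -adjoinedVoltage m sym δ k j :=
  rowsSeparated_option (h.columnsSeparated_celestialVoltage hlen) Finset.neg_empty
    (fun _ => (Finset.singleton_nonempty _).neg) (j₀ := ⟨0, by omega⟩)
    (isAperiodic_singleton _).neg

theorem sum_card_adjoinedVoltage_column (h : IsAdmissible m sym δ) (hlen : sym.length = 5)
    (j : Option (Fin sym.length)) : ∑ k, (adjoinedVoltage m sym δ k j).card = 5 := by
  rcases j with _ | j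
  · simp only [Fintype.sum_option, adjoinedVoltage, Finset.card_empty, Finset.card_singleton,
      Finset.sum_const, Finset.card_univ, Fintype.card_fin, hlen, smul_eq_mul]
  · simp only [Fintype.sum_option, adjoinedVoltage, Finset.card_singleton,
      h.sum_card_celestialVoltage_column (by omega : 2 ≤ sym.length)]

theorem sum_card_adjoinedVoltage_row (h : IsAdmissible m sym δ) (hlen : sym.length = 5)
    (k : Option (Fin sym.length)) : ∑ j, (adjoinedVoltage m sym δ k j).card = 5 := by
  rcases k with _ | k
  · simp only [Fintype.sum_option, adjoinedVoltage, Finset.card_empty, Finset.card_singleton,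
      Finset.sum_const, Finset.card_univ, Fintype.card_fin, hlen, smul_eq_mul]
  · simp only [Fintype.sum_option, adjoinedVoltage, Finset.card_singleton,
      h.sum_card_celestialVoltage_row (by omega : 2 ≤ sym.length)]

theorem isExtendedConfiguration_adjoin (h : IsAdmissible m sym δ) (hodd : Odd m)
    (hlen : sym.length = 5) :
    IsExtendedConfiguration (6 * m) 5 (celestialPoints m sym ∪ Set.range (farPoint m))
      (celestialLines m sym ∪ Set.range (diameter m)) := by
  have hm : m ≠ 0 := hodd.pos.ne'
  have : NeZero m := ⟨hm⟩
  rw [← range_adjoinedPoint, ← range_adjoinedLine]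
  refine ⟨?_, ?_, ?_⟩
  · rintro _ ⟨⟨_ | k, i⟩, rfl⟩
    exacts [finrank_pointAtInfinity _, finrank_celestialPoint h.proper k.2.le i]
  · rintro _ ⟨⟨_ | j, i⟩, rfl⟩
    exacts [finrank_diameter m i, finrank_celestialLine h.proper j.2 i]
  have hcard : Fintype.card (Option (Fin sym.length)) = 6 := by
    rw [Fintype.card_option, Fintype.card_fin, hlen]
  rw [← hcard]
  refine isConfiguration_of_periodic ?_ ?_ (h.adjoinedPoint_le_adjoinedLine_iff_mem hodd)
    (h.rowsSeparated_adjoinedVoltage (by omega)) (h.columnsSeparated_adjoinedVoltage (by omega))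
    rfl (h.sum_card_adjoinedVoltage_column hlen) (h.sum_card_adjoinedVoltage_row hlen)
  · rintro (_ | k)
    exacts [farPoint_periodic hm, celestialPoint_periodic hm sym k]
  · rintro (_ | j)
    exacts [diameter_periodic hm, celestialLine_periodic hm sym j]

end IsAdmissible

theorem D5Points_eq_union (ℓ : ℕ) :
    D5Points ℓ = celestialPoints (2 * ℓ + 1) symbolD5 ∪ Set.range (farPoint (2 * ℓ + 1)) := by
  have hangle (i : ℤ) : farPoint (2 * ℓ + 1) i = pointAtInfinity (2 * i * π / (2 * ℓ + 1)) := by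
    rw [farPoint, stepAngle]
    push_cast
    rw [mul_div_assoc']
  ext p
  simp only [D5Points, Set.mem_union, Set.mem_ofPred_eq, Set.mem_range, hangle, eq_comm]

theorem D5Lines_eq_union (ℓ : ℕ) :
    D5Lines ℓ = celestialLines (2 * ℓ + 1) symbolD5 ∪ Set.range (diameter (2 * ℓ + 1)) := by
  ext l
  simp only [D5Lines, Set.mem_union, Set.mem_ofPred_eq, Set.mem_range, eq_comm]

theorem isExtendedConfiguration_D5 {ℓ : ℕ} (hℓ : 5 ≤ ℓ) :
    IsExtendedConfiguration (12 * ℓ + 6) 5 (D5Points ℓ) (D5Lines ℓ) := by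
  rw [D5Points_eq_union, D5Lines_eq_union, show 12 * ℓ + 6 = 6 * (2 * ℓ + 1) by ring]
  exact (isAdmissible_symbolD5 (by omega)).isExtendedConfiguration_adjoin ⟨ℓ, rfl⟩ rfl

end Adjoin

/-! ### From the extended plane to the Euclidean plane -/

theorem IsConfiguration.transfer {P P' L L' : Type*} {inc : P → L → Prop} {inc' : P' → L' → Prop}
    {n k : ℕ} {pts : Set P} {lns : Set L} (h : IsConfiguration inc n k pts lns)
    {φ : P' → P} {ψ : L → L'} (hφ : Function.Injective φ) (hrange : pts ⊆ Set.range φ)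
    (hψ : Set.InjOn ψ lns) (hinc : ∀ p l, inc' p (ψ l) ↔ inc (φ p) l) :
    IsConfiguration inc' n k (φ ⁻¹' pts) (ψ '' lns) := by
  obtain ⟨hpts, hlns, hptsn, hlnsn, hcol, hrow⟩ := h
  refine ⟨hpts.preimage hφ.injOn, hlns.image ψ, ?_, ?_, ?_, ?_⟩
  · rw [Set.ncard_preimage_of_injective_subset_range hφ hrange, hptsn]
  · rw [hψ.ncard_image, hlnsn]
  · rintro _ ⟨l, hl, rfl⟩
    have hset : {p ∈ φ ⁻¹' pts | inc' p (ψ l)} = φ ⁻¹' {p ∈ pts | inc p l} := by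
      ext p
      simp only [hinc, Set.mem_preimage, Set.mem_ofPred_eq]
    rw [hset, Set.ncard_preimage_of_injective_subset_range hφ
      fun p hp => hrange hp.1, hcol l hl]
  · intro p hp
    have hset : {l ∈ ψ '' lns | inc' p l} = ψ '' {l ∈ lns | inc (φ p) l} := by
      ext l
      constructor
      · rintro ⟨⟨l, hl, rfl⟩, hpl⟩
        exact ⟨l, ⟨hl, (hinc p l).1 hpl⟩, rfl⟩
      · rintro ⟨l, ⟨hl, hpl⟩, rfl⟩
        exact ⟨⟨l, hl, rfl⟩, (hinc p l).2 hpl⟩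
    rw [hset, (hψ.mono fun l hl => hl.1).ncard_image, hrow _ hp]

theorem ordinaryPoint_le_iff_mem_affineLine (x : E2) (W : Flat) :
    ordinaryPoint (x 0) (x 1) ≤ W ↔ x ∈ affineLine W :=
  Submodule.span_singleton_le_iff_mem _ _

theorem ordinaryPoint_injective :
    Function.Injective fun x : E2 => ordinaryPoint (x 0) (x 1) := by
  intro x y h
  have hmem : ![x 0, x 1, 1] ∈ ordinaryPoint (y 0) (y 1) :=
    (show ordinaryPoint (x 0) (x 1) = ordinaryPoint (y 0) (y 1) from h) ▸
      Submodule.mem_span_singleton_self _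
  obtain ⟨c, hc⟩ := Submodule.mem_span_singleton.1 hmem
  obtain rfl : c = 1 := by simpa using congrFun hc 2
  ext i
  fin_cases i
  · simpa using (congrFun hc 0).symm
  · simpa using (congrFun hc 1).symm

theorem exists_ordinaryPoint_le {W : Flat} (h : ¬ W ≤ lineAtInfinity) :
    ∃ x : E2, ordinaryPoint (x 0) (x 1) ≤ W := by
  obtain ⟨v, hv, hv'⟩ := SetLike.not_le_iff_exists.1 h
  have hv2 : v 2 ≠ 0 := by simpa [lineAtInfinity] using hv'
  refine ⟨!₂[(v 2)⁻¹ * v 0, (v 2)⁻¹ * v 1], ?_⟩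
  rw [ordinaryPoint, Submodule.span_singleton_le_iff_mem]
  convert W.smul_mem (v 2)⁻¹ hv using 1
  ext i
  fin_cases i <;> simp [hv2]

theorem exists_ordinaryPoint_eq {p : Flat} (hp : Module.finrank ℝ p = 1)
    (h : ¬ p ≤ lineAtInfinity) : ∃ x : E2, ordinaryPoint (x 0) (x 1) = p := by
  obtain ⟨x, hx⟩ := exists_ordinaryPoint_le h
  exact ⟨x, Submodule.eq_of_le_of_finrank_le hx (by rw [hp, finrank_ordinaryPoint])⟩

theorem affineLine_sup (x y : E2) :
    affineLine (ordinaryPoint (x 0) (x 1) ⊔ ordinaryPoint (y 0) (y 1)) = line[ℝ, x, y] := by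
  ext z
  rw [← ordinaryPoint_le_iff_mem_affineLine, ordinaryPoint, ordinaryPoint, ordinaryPoint,
    Submodule.span_singleton_le_iff_mem, ← Submodule.span_union, Set.singleton_union,
    Submodule.mem_span_pair, mem_affineSpan_pair_iff_exists_lineMap_eq]
  constructor
  · rintro ⟨a, b, h⟩
    have h0 : a * x 0 + b * y 0 = z 0 := by simpa using congrFun h 0
    have h1 : a * x 1 + b * y 1 = z 1 := by simpa using congrFun h 1
    have h2 : a + b = 1 := by simpa using congrFun h 2
    obtain rfl : a = 1 - b := by linarith
    refine ⟨b, ?_⟩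
    ext i
    fin_cases i <;> simp [AffineMap.lineMap_apply] <;> linarith
  · rintro ⟨r, rfl⟩
    refine ⟨1 - r, r, ?_⟩
    ext i
    fin_cases i <;> simp [AffineMap.lineMap_apply] <;> ring

theorem affineLine_eq_of_parallel {W W' : Flat} (h : ¬ W ⊓ W' ≤ lineAtInfinity)
    (hp : (affineLine W).Parallel (affineLine W')) : affineLine W = affineLine W' := by
  obtain ⟨x, hx⟩ := exists_ordinaryPoint_le h
  obtain ⟨hxW, hxW'⟩ := le_inf_iff.1 hx
  rw [ordinaryPoint_le_iff_mem_affineLine] at hxW hxW'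
  exact AffineSubspace.ext_of_direction_eq hp.direction_eq ⟨x, hxW, hxW'⟩

theorem finrank_inf_of_ne {l l' : Flat} (hl : Module.finrank ℝ l = 2)
    (hl' : Module.finrank ℝ l' = 2) (h : l ≠ l') : Module.finrank ℝ (l ⊓ l' : Flat) = 1 := by
  have htop : Module.finrank ℝ (⊤ : Flat) = 3 := by simp
  have hsup : l ⊔ l' = ⊤ :=
    (covBy_of_finrank_eq_add_one le_top (by omega)).wcovBy.sup_eq
      (covBy_of_finrank_eq_add_one le_top (by omega)).wcovBy h
  have := Submodule.finrank_sup_add_finrank_inf_eq l l'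
  rw [hsup] at this
  omega

namespace IsExtendedConfiguration

variable {n k : ℕ} {S T : Set Flat}

theorem exists_ordinaryPoint_sup_eq (h : IsExtendedConfiguration n k S T) (hk : 2 ≤ k)
    (hord : ∀ p ∈ S, ¬ p ≤ lineAtInfinity) {W : Flat} (hW : W ∈ T) :
    ∃ x y : E2, x ≠ y ∧ ordinaryPoint (x 0) (x 1) ∈ S ∧
      ordinaryPoint (x 0) (x 1) ⊔ ordinaryPoint (y 0) (y 1) = W := by
  obtain ⟨hS, hT, -, -, -, -, hcol, -⟩ := h
  have hcard : {p ∈ S | p ≤ W}.ncard = k := hcol W hW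
  have hfin : {p ∈ S | p ≤ W}.Finite := Set.finite_of_ncard_pos (by omega)
  obtain ⟨p, q, hp, hq, hpq⟩ := (Set.one_lt_ncard_iff hfin).1 (by omega)
  obtain ⟨x, rfl⟩ := exists_ordinaryPoint_eq (hS p hp.1) (hord p hp.1)
  obtain ⟨y, rfl⟩ := exists_ordinaryPoint_eq (hS q hq.1) (hord q hq.1)
  exact ⟨x, y, fun hxy => hpq (by rw [hxy]), hp.1,
    sup_eq_of_finrank_eq (hS _ hp.1) (hS _ hq.1) (hT W hW) hp.2 hq.2 hpq⟩

theorem injOn_affineLine (h : IsExtendedConfiguration n k S T) (hk : 2 ≤ k)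
    (hord : ∀ p ∈ S, ¬ p ≤ lineAtInfinity) : Set.InjOn affineLine T := by
  have hle {W W' : Flat} (hW : W ∈ T) (hWW' : affineLine W = affineLine W') : W ≤ W' := by
    obtain ⟨x, y, -, -, rfl⟩ := h.exists_ordinaryPoint_sup_eq hk hord hW
    rw [sup_le_iff, ordinaryPoint_le_iff_mem_affineLine, ordinaryPoint_le_iff_mem_affineLine,
      ← hWW', affineLine_sup]
    exact ⟨left_mem_affineSpan_pair ℝ x y, right_mem_affineSpan_pair ℝ x y⟩
  exact fun W hW W' hW' hWW' => (hle hW hWW').antisymm (hle hW' hWW'.symm)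

theorem isGeometricConfiguration_affine (h : IsExtendedConfiguration n k S T) (hk : 2 ≤ k)
    (hord : ∀ p ∈ S, ¬ p ≤ lineAtInfinity) :
    IsGeometricConfiguration n k (affinePoints S) (affineLines T) := by
  refine ⟨?_, h.2.2.transfer ordinaryPoint_injective
    (fun p hp => exists_ordinaryPoint_eq (h.1 p hp) (hord p hp)) (h.injOn_affineLine hk hord)
    fun x W => (ordinaryPoint_le_iff_mem_affineLine x W).symm⟩
  rintro _ ⟨W, hW, rfl⟩
  obtain ⟨x, y, hxy, -, rfl⟩ := h.exists_ordinaryPoint_sup_eq hk hord hW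
  rw [affineLine_sup, direction_affineSpan, vectorSpan_pair]
  exact ⟨⟨x, left_mem_affineSpan_pair ℝ x y⟩, finrank_span_singleton (vsub_ne_zero.2 hxy)⟩

theorem not_line_le_lineAtInfinity (h : IsExtendedConfiguration n k S T) (hk : 2 ≤ k)
    (hord : ∀ p ∈ S, ¬ p ≤ lineAtInfinity) {W : Flat} (hW : W ∈ T) : ¬ W ≤ lineAtInfinity := by
  obtain ⟨x, y, -, hx, rfl⟩ := h.exists_ordinaryPoint_sup_eq hk hord hW
  exact fun hle => hord _ hx (le_sup_left.trans hle)

theorem ne_of_forall_not_le (h : IsExtendedConfiguration n k S T) (hk : 2 ≤ k)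
    (hord : ∀ p ∈ S, ¬ p ≤ lineAtInfinity) {W D : Flat} (hW : W ∈ T)
    (hno : ∀ p ∈ S, ¬ (p ≤ W ∧ p ≤ D)) : W ≠ D := by
  obtain ⟨x, y, -, hx, rfl⟩ := h.exists_ordinaryPoint_sup_eq hk hord hW
  rintro rfl
  exact hno _ hx ⟨le_sup_left, le_sup_left⟩

theorem hasIndependentPencils_of_meet (h : IsExtendedConfiguration n k S T) (hk : 2 ≤ k)
    (hord : ∀ p ∈ S, ¬ p ≤ lineAtInfinity) {W D : Flat} (hW : W ∈ T) (hD : D ∈ T)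
    (hno : ∀ p ∈ S, ¬ (p ≤ W ∧ p ≤ D)) (hmeet : ¬ W ⊓ D ≤ lineAtInfinity) :
    HasIndependentPencils 1 1 (affinePoints S) (affineLines T) := by
  refine ⟨{affineLine W}, {affineLine D}, ?_, ?_, Finset.card_singleton _,
    Finset.card_singleton _, ?_, ?_, ?_, ?_⟩
  · rw [Finset.coe_singleton, Set.singleton_subset_iff]
    exact Set.mem_image_of_mem _ hW
  · rw [Finset.coe_singleton, Set.singleton_subset_iff]
    exact Set.mem_image_of_mem _ hD
  all_goals simp only [Finset.mem_singleton, forall_eq]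
  · exact AffineSubspace.Parallel.refl _
  · exact AffineSubspace.Parallel.refl _
  · exact fun hp => h.ne_of_forall_not_le hk hord hW hno
      (h.injOn_affineLine hk hord hW hD (affineLine_eq_of_parallel hmeet hp))
  · simp only [← ordinaryPoint_le_iff_mem_affineLine]
    exact fun x hx => hno _ hx

theorem hasIndependentPencils_of_two_meets (h : IsExtendedConfiguration n k S T) (hk : 2 ≤ k)
    (hord : ∀ p ∈ S, ¬ p ≤ lineAtInfinity) {W D D' : Flat} (hW : W ∈ T) (hD : D ∈ T) (hD' : D' ∈ T)
    (hDD' : W ⊓ D ≠ W ⊓ D')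
    (hno : ∀ p ∈ S, ¬ (p ≤ W ∧ p ≤ D)) (hno' : ∀ p ∈ S, ¬ (p ≤ W ∧ p ≤ D')) :
    HasIndependentPencils 1 1 (affinePoints S) (affineLines T) := by
  have hWD := h.ne_of_forall_not_le hk hord hW hno
  have hWD' := h.ne_of_forall_not_le hk hord hW hno'
  by_cases hmeet : W ⊓ D ≤ lineAtInfinity
  · refine h.hasIndependentPencils_of_meet hk hord hW hD' hno' fun hmeet' => ?_
    have hsup : W ⊓ D ⊔ W ⊓ D' = W :=
      sup_eq_of_finrank_eq (finrank_inf_of_ne (h.2.1 W hW) (h.2.1 D hD) hWD)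
        (finrank_inf_of_ne (h.2.1 W hW) (h.2.1 D' hD') hWD') (h.2.1 W hW) inf_le_left inf_le_left
        hDD'
    exact h.not_line_le_lineAtInfinity hk hord hW (hsup ▸ sup_le hmeet hmeet')
  · exact h.hasIndependentPencils_of_meet hk hord hW hD hno hmeet

theorem projImage (h : IsExtendedConfiguration n k S T) (f : (Fin 3 → ℝ) ≃ₗ[ℝ] (Fin 3 → ℝ)) :
    IsExtendedConfiguration n k (projImage f S) (projImage f T) := by
  refine ⟨?_, ?_, ?_⟩
  · rintro _ ⟨p, hp, rfl⟩
    exact (f.finrank_map_eq p).trans (h.1 p hp)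
  · rintro _ ⟨l, hl, rfl⟩
    exact (f.finrank_map_eq l).trans (h.2.1 l hl)
  · let e : Flat ≃o Flat := Submodule.orderIsoMapComap f
    have himage (A : Set Flat) : DFive.projImage f A = e.symm ⁻¹' A := e.image_eq_preimage_symm A
    rw [himage S]
    exact h.2.2.transfer e.symm.injective (fun p _ => e.symm.surjective p) e.injective.injOn
      fun p l => e.symm_apply_le.symm

end IsExtendedConfiguration

/-! ### A projective transformation in general position -/

theorem finrank_lineAtInfinity : Module.finrank ℝ lineAtInfinity = 2 := by
  have hne : (LinearMap.proj 2 : Module.Dual ℝ (Fin 3 → ℝ)) ≠ 0 := fun h => by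
    simpa using LinearMap.congr_fun h 1
  have := Module.Dual.finrank_ker_add_one_of_ne_zero hne
  rw [Module.finrank_fin_fun] at this
  exact Nat.succ.inj this

theorem exists_map_eq_of_finrank_eq {K V : Type*} [DivisionRing K] [AddCommGroup V] [Module K V]
    [FiniteDimensional K V] {W W' : Submodule K V} (h : Module.finrank K W = Module.finrank K W') :
    ∃ f : V ≃ₗ[K] V, W.map (f : V →ₗ[K] V) = W' := by
  obtain ⟨f, hf⟩ := Submodule.exists_linearEquiv_restrict_eq (LinearEquiv.ofFinrankEq W W' h)
  have hle : W.map (f : V →ₗ[K] V) ≤ W' := by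
    rintro _ ⟨x, hx, rfl⟩
    exact hf ⟨x, hx⟩ ▸ SetLike.coe_mem _
  exact ⟨f, Submodule.eq_of_le_of_finrank_eq hle ((f.finrank_map_eq W).trans h)⟩

theorem exists_not_le_ker {K V : Type*} [Field K] [Infinite K] [AddCommGroup V] [Module K V]
    {A : Set (Submodule K V)} (hA : A.Finite) :
    ∃ φ : Module.Dual K V, ∀ W ∈ A, W ≠ ⊥ → ¬ W ≤ LinearMap.ker φ := by
  have : Finite {W // W ∈ A ∧ W ≠ ⊥} := (hA.subset fun W hW => hW.1).to_subtype
  choose v hvW hv using fun W : {W // W ∈ A ∧ W ≠ ⊥} => Submodule.exists_mem_ne_zero_of_ne_bot W.2.2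
  obtain ⟨φ, hφ⟩ := Module.exists_dual_forall_apply_ne_zero (K := K) v hv
  exact ⟨φ, fun W hW hne hle => hφ ⟨W, hW, hne⟩ (hle (hvW ⟨W, hW, hne⟩))⟩

theorem exists_linearEquiv_not_map_le_lineAtInfinity {A : Set Flat} (hA : A.Finite) :
    ∃ f : (Fin 3 → ℝ) ≃ₗ[ℝ] (Fin 3 → ℝ), ∀ W ∈ A, W ≠ ⊥ →
      ¬ W.map (f : (Fin 3 → ℝ) →ₗ[ℝ] (Fin 3 → ℝ)) ≤ lineAtInfinity := by
  obtain ⟨φ, hφ⟩ := exists_not_le_ker (hA.insert ⊤)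
  have hne : φ ≠ 0 := by
    rintro rfl
    exact hφ ⊤ (Set.mem_insert _ _) top_ne_bot LinearMap.ker_zero.ge
  have hker : Module.finrank ℝ (LinearMap.ker φ) = Module.finrank ℝ lineAtInfinity := by
    have := Module.Dual.finrank_ker_add_one_of_ne_zero hne
    rw [Module.finrank_fin_fun] at this
    rw [finrank_lineAtInfinity]
    exact Nat.succ.inj this
  obtain ⟨f, hf⟩ := exists_map_eq_of_finrank_eq hker
  refine ⟨f, fun W hW hne hle => hφ W (Set.mem_insert_of_mem _ hW) hne ?_⟩
  rwa [← hf, Submodule.map_le_map_iff_of_injective f.injective] at hle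

theorem IsExtendedConfiguration.exists_projImage_without_parallels {n k : ℕ} {S T : Set Flat}
    (h : IsExtendedConfiguration n k S T) :
    ∃ f : (Fin 3 → ℝ) ≃ₗ[ℝ] (Fin 3 → ℝ), ProjectsIntoPlane f S ∧
      ∀ a ∈ affineLines (DFive.projImage f T), ∀ b ∈ affineLines (DFive.projImage f T),
        a.Parallel b → a = b := by
  obtain ⟨hS, hT, hSfin, hTfin, -⟩ := h
  obtain ⟨f, hf⟩ := exists_linearEquiv_not_map_le_lineAtInfinity
    (hSfin.union (hTfin.image2 (· ⊓ ·) hTfin))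
  refine ⟨f, ?_, ?_⟩
  · rintro _ ⟨p, hp, rfl⟩
    exact hf p (.inl hp) (Submodule.one_le_finrank_iff.1 (hS p hp).ge)
  · rintro _ ⟨_, ⟨W, hW, rfl⟩, rfl⟩ _ ⟨_, ⟨W', hW', rfl⟩, rfl⟩ hpar
    obtain rfl | hne := eq_or_ne W W'
    · rfl
    refine affineLine_eq_of_parallel ?_ hpar
    rw [← Submodule.map_inf _ f.injective]
    exact hf _ (.inr ⟨W, hW, W', hW', rfl⟩)
      (Submodule.one_le_finrank_iff.1 (finrank_inf_of_ne (hT W hW) (hT W' hW') hne).ge)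

/-! ### Independent pencils -/

section Pencils

theorem inf_ne_inf_of_not_le {p l l' W : Flat} (hp : Module.finrank ℝ p = 1)
    (hl : Module.finrank ℝ l = 2) (hl' : Module.finrank ℝ l' = 2) (hW : Module.finrank ℝ W = 2)
    (hpl : p ≤ l) (hpl' : p ≤ l') (hll' : l ≠ l') (hpW : ¬ p ≤ W) : W ⊓ l ≠ W ⊓ l' := by
  intro heq
  have hle : W ⊓ l ≤ p := by
    rw [← inf_eq_of_finrank_eq hp hl hl' hpl hpl' hll']
    exact le_inf inf_le_right (heq.trans_le inf_le_right)
  have hWl : W ≠ l := fun hWl => hpW (hpl.trans hWl.ge)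
  have hmeet : W ⊓ l = p :=
    Submodule.eq_of_le_of_finrank_eq hle ((finrank_inf_of_ne hW hl hWl).trans hp.symm)
  exact hpW (hmeet.ge.trans inf_le_left)

theorem IsExtendedConfiguration.hasIndependentPencils_projImage {n k : ℕ} {S T : Set Flat}
    (h : IsExtendedConfiguration n k S T) (hk : 2 ≤ k) {f : (Fin 3 → ℝ) ≃ₗ[ℝ] (Fin 3 → ℝ)}
    (hf : ProjectsIntoPlane f S) {W D D' : Flat} (hW : W ∈ T) (hD : D ∈ T) (hD' : D' ∈ T)
    (hDD' : W ⊓ D ≠ W ⊓ D')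
    (hno : ∀ p ∈ S, ¬ (p ≤ W ∧ p ≤ D)) (hno' : ∀ p ∈ S, ¬ (p ≤ W ∧ p ≤ D')) :
    HasIndependentPencils 1 1 (affinePoints (DFive.projImage f S))
      (affineLines (DFive.projImage f T)) := by
  have hno_map {E : Flat} (hE : ∀ p ∈ S, ¬ (p ≤ W ∧ p ≤ E)) :
      ∀ p ∈ DFive.projImage f S, ¬ (p ≤ W.map (f : (Fin 3 → ℝ) →ₗ[ℝ] (Fin 3 → ℝ)) ∧
        p ≤ E.map (f : (Fin 3 → ℝ) →ₗ[ℝ] (Fin 3 → ℝ))) := by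
    rintro _ ⟨p, hp, rfl⟩
    simpa only [Submodule.map_le_map_iff_of_injective f.injective] using hE p hp
  refine (h.projImage f).hasIndependentPencils_of_two_meets hk hf ⟨W, hW, rfl⟩ ⟨D, hD, rfl⟩
    ⟨D', hD', rfl⟩ ?_ (hno_map hno) (hno_map hno')
  simp only [← Submodule.map_inf _ f.injective]
  exact (Submodule.map_injective_of_injective f.injective).ne hDD'

theorem not_origin_le_celestialLine {m : ℕ} {sym : List (ℤ × ℤ)} {j : ℕ}
    (h : HasProperSpans m sym) (hj : j < sym.length) (i : ℤ) :
    ¬ ordinaryPoint 0 0 ≤ celestialLine m sym j i := by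
  rw [celestialLine_eq_polarLine h hj, ordinaryPoint_le_polarLine_iff, zero_mul, zero_mul, add_zero]
  exact (mul_pos (celestialRadius_pos h hj.le) (stepCos_pos_of_span (h.of_lt_length hj).1)).ne

theorem IsAdmissible.dvd_of_le_celestialLine_of_le_diameter {m : ℕ} {sym : List (ℤ × ℤ)} {δ : ℤ}
    (h : IsAdmissible m sym δ) {j k : ℕ} (hj : j + 1 < sym.length) (hk : k < sym.length)
    {b c a : ℤ} (hline : celestialPoint m sym k b ≤ celestialLine m sym j c)
    (hdiam : celestialPoint m sym k b ≤ diameter m a) :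
    ((m : ℤ) ∣ 2 * (c - a) + celestialShift sym j ∨
      (m : ℤ) ∣ 2 * (c - a) + celestialShift sym j + 2 * lineSpan sym j) ∨
    ((m : ℤ) ∣ 2 * (c - a) + celestialShift sym (j + 1) ∨
      (m : ℤ) ∣ 2 * (c - a) + celestialShift sym (j + 1) + 2 * pointSpan sym j) := by
  have hm : m ≠ 0 := h.ne_zero (List.ne_nil_of_length_pos (by omega))
  rw [celestialPoint_le_diameter_iff h.proper hm hk.le] at hdiam
  obtain ⟨x, hx⟩ := hdiam
  obtain rfl | hkj := eq_or_ne k j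
  · rw [celestialPoint_le_celestialLine_self_iff h.proper hk] at hline
    refine .inl (hline.imp ?_ ?_) <;> rintro ⟨y, hy⟩ <;>
      exact ⟨x - 2 * y, by linear_combination hx - 2 * hy⟩
  obtain rfl | hkj' := eq_or_ne k (j + 1)
  · rw [celestialPoint_succ_le_celestialLine_iff h.proper (by omega)] at hline
    refine .inr (hline.imp ?_ ?_) <;> rintro ⟨y, hy⟩ <;>
      exact ⟨x - 2 * y, by linear_combination hx - 2 * hy⟩
  · rw [celestialPoint_le_celestialLine_iff h.proper hk.le (by omega)] at hline
    exact absurd hline (h.no_accidental_incidence k hk j (by omega) hkj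
      (by rwa [Nat.mod_eq_of_lt hj]) _ (by omega))

theorem forall_D5Points_not_le_line_and_diameter {ℓ : ℕ} (hℓ : 5 ≤ ℓ) {a : ℤ}
    (ha : a = 1 ∨ a = 4) :
    ∀ p ∈ D5Points ℓ,
      ¬ (p ≤ celestialLine (2 * ℓ + 1) symbolD5 0 0 ∧ p ≤ diameter (2 * ℓ + 1) a) := by
  rw [D5Points_eq_union]
  rintro _ (⟨k, hk, b, rfl⟩ | ⟨b, rfl⟩) ⟨hline, hdiam⟩
  · have hdvd := (isAdmissible_symbolD5 (by omega)).dvd_of_le_celestialLine_of_le_diameter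
      (by decide) hk hline hdiam
    rw [celestialShift_symbolD5.1, celestialShift_symbolD5.2.1, lineSpan_symbolD5.1,
      show pointSpan symbolD5 0 = 1 from rfl] at hdvd
    have hzero {z : ℤ} (hz : |z| < 11) (hdvd : ((2 * ℓ + 1 : ℕ) : ℤ) ∣ z) : z = 0 :=
      Int.eq_zero_of_abs_lt_dvd hdvd (by omega)
    rcases ha with rfl | rfl <;> rcases hdvd with (h | h) | (h | h) <;>
      exact absurd (hzero (by norm_num) h) (by norm_num)
  · exact not_pointAtInfinity_le_diameter ⟨ℓ, rfl⟩ b a hdiam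

theorem hasIndependentPencils_D5 {ℓ : ℕ} (hℓ : 5 ≤ ℓ) {f : (Fin 3 → ℝ) ≃ₗ[ℝ] (Fin 3 → ℝ)}
    (hf : ProjectsIntoPlane f (D5Points ℓ)) :
    HasIndependentPencils 1 1 (affinePoints (projImage f (D5Points ℓ)))
      (affineLines (projImage f (D5Lines ℓ))) := by
  have hproper : HasProperSpans (2 * ℓ + 1) symbolD5 := hasProperSpans_symbolD5 (by omega)
  have hlen : 0 < symbolD5.length := by decide
  have hne : diameter (2 * ℓ + 1) 1 ≠ diameter (2 * ℓ + 1) 4 := fun heq => by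
    have hvertex : celestialPoint (2 * ℓ + 1) symbolD5 0 1 ≤ diameter (2 * ℓ + 1) 4 :=
      heq ▸ le_sup_left
    rw [celestialPoint_le_diameter_iff hproper (by omega) hlen.le, celestialShift_zero] at hvertex
    have := Int.eq_zero_of_abs_lt_dvd hvertex (by norm_num; omega)
    omega
  have hmeets := inf_ne_inf_of_not_le (finrank_ordinaryPoint 0 0) (finrank_diameter _ _)
    (finrank_diameter _ _) (finrank_celestialLine hproper hlen 0) le_sup_right le_sup_right
    hne (not_origin_le_celestialLine hproper hlen 0)
  exact (isExtendedConfiguration_D5 hℓ).hasIndependentPencils_projImage (by norm_num) hf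
    (.inl ⟨0, hlen, 0, rfl⟩) (.inr ⟨1, rfl⟩) (.inr ⟨4, rfl⟩) hmeets
    (forall_D5Points_not_le_line_and_diameter hℓ (.inl rfl))
    (forall_D5Points_not_le_line_and_diameter hℓ (.inr rfl))

end Pencils

end DFive

end

theorem mainTheorem10 (ℓ : ℕ) (hℓ : 5 ≤ ℓ) :
    DFive.IsCelestial (2 * ℓ + 1) DFive.symbolD5 ∧
    DFive.IsExtendedConfiguration (12 * ℓ + 6) 5 (DFive.D5Points ℓ) (DFive.D5Lines ℓ) ∧
    (∃ f : (Fin 3 → ℝ) ≃ₗ[ℝ] (Fin 3 → ℝ), DFive.ProjectsIntoPlane f (DFive.D5Points ℓ) ∧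
      ∀ a ∈ DFive.affineLines (DFive.projImage f (DFive.D5Lines ℓ)),
      ∀ b ∈ DFive.affineLines (DFive.projImage f (DFive.D5Lines ℓ)), a.Parallel b → a = b) ∧
    (∀ f : (Fin 3 → ℝ) ≃ₗ[ℝ] (Fin 3 → ℝ), DFive.ProjectsIntoPlane f (DFive.D5Points ℓ) →
      DFive.IsGeometricConfiguration (12 * ℓ + 6) 5
        (DFive.affinePoints (DFive.projImage f (DFive.D5Points ℓ)))
        (DFive.affineLines (DFive.projImage f (DFive.D5Lines ℓ))) ∧
      DFive.HasIndependentPencils 1 1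
        (DFive.affinePoints (DFive.projImage f (DFive.D5Points ℓ)))
        (DFive.affineLines (DFive.projImage f (DFive.D5Lines ℓ)))) := by
  have h := DFive.isExtendedConfiguration_D5 hℓ
  exact ⟨(DFive.isAdmissible_symbolD5 (by omega)).isCelestial (by decide), h,
    h.exists_projImage_without_parallels,
    fun f hf => ⟨(h.projImage f).isGeometricConfiguration_affine (by norm_num) hf,
      DFive.hasIndependentPencils_D5 hℓ hf⟩⟩
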